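/- Let $S$ be a bosonic target mode with Hamiltonian $H_S=\omega_0\hat a^\dagger\hat a$, let $M$ be a machine of $N\ge 1$ modes with Hamiltonian $H_M=\sum_{j=1}^N\omega_j\hat b_j^\dagger\hat b_j$, $\omega_1\le\dots\le\omega_N$, and let $R$ be a reservoir of $K$ modes with Hamiltonian $H_R=\sum_{k=1}^K\nu_k\hat c_k^\dagger\hat c_k$, all frequencies being positive. Initially $SM$ is in the Gibbs state $\tau_S\otimes\tau_M$ at inverse temperature $\beta>0$. A Gaussian heat-bath algorithmic cooling protocol is a finite sequence of rounds. In each round the state $\rho$ of $SM$ is replaced by $\mathrm{tr}_R[U(V\rho V^\dagger\otimes\tau_R)U^\dagger]$, where $\tau_R$ is the Gibbs state of $R$ at inverse temperature $\beta$, the recharging unitary $V$ is an arbitrary Gaussian unitary on $SM$, and the thermalizing unitary $U$ is a Gaussian unitary on $SMR$ that preserves the energy, $[U,H_S+H_M+H_R]=0$ (in particular, $U$ may act on $MR$ only). $V$ and $U$ may change from round to round. The thermal excitation of a single-mode state $\rho$ is $\mathfrak n(\rho)=\min_W\mathrm{tr}(\hat a^\dagger\hat a\,W\rho W^\dagger)$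 over all single-mode Gaussian unitaries $W$. Let $\rho_S$ be the final state of $S$; its effective inverse temperature is $\beta^*=\frac1{\omega_0}\ln\frac{\mathfrak n(\rho_S)+1}{\mathfrak n(\rho_S)}$. (i) For every $\lambda>1$ there is a Gaussian protocol with $\beta^*=\lambda\beta$ if and only if $\omega_N\ge\lambda\omega_0$. (ii) Every Gaussian protocol satisfies $\beta^*\le\max\{1,\omega_N/\omega_0\}\,\beta$; in particular, $\beta^*\le(\omega_N/\omega_0)\beta$ if $\omega_N\ge\omega_0$. (iii) The protocol of one round in which $V$ is the SWAP of $S$ with the machine mode of frequency $\omega_N$ and $U$ is the identity has $\beta^*=(\omega_N/\omega_0)\beta$. For every $\lambda\ge1$ with $\lambda\omega_0\le\omega_N$, the protocol of one round in which $V$ is the beam splitter $\exp[-i\theta(\hat a^\dagger\hat b_N+\hat a\hat b_N^\dagger)]$ with a suitable angle $\theta$ and $U$ is the identity is Gaussian and has $\beta^*=\lambda\beta$. -/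

import Mathlib

open scoped ENNReal InnerProductSpace

noncomputable section

namespace HBAC

/-! ### Bosonic modes and their Fock space -/

/-- The Hilbert space of bosonic modes labelled by `ι`, in the occupation number representation:
square summable functions of the occupation numbers `n : ι → ℕ`.
It is `⨂ i : ι, ℓ²(ℕ)`, and `Fock (ι ⊕ κ)` is `Fock ι ⊗ Fock κ`. -/
abbrev Fock (ι : Type) : Type := lp (fun _ : ι → ℕ => ℂ) 2

/-- Bounded operators on the Fock space. -/
abbrev Op (ι : Type) : Type := Fock ι →L[ℂ] Fock ι

/-- Unitary operators on the Fock space. -/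
abbrev Uni (ι : Type) : Type := Fock ι ≃ₗᵢ[ℂ] Fock ι

theorem elim_injective {ι κ : Type} (k : κ → ℕ) :
    Function.Injective (fun n : ι → ℕ => (Sum.elim n k : ι ⊕ κ → ℕ)) := by
  intro n m h
  funext i
  exact congrFun h (Sum.inl i)

section TensorKet

variable {ι κ : Type} [Fintype κ]

/-- The coordinates of `ψ ⊗ |k⟩`. -/
def tensorKetFun (k : κ → ℕ) (ψ : (ι → ℕ) → ℂ) : (ι ⊕ κ → ℕ) → ℂ :=
  fun f => if (fun j => f (Sum.inr j)) = k then ψ (fun i => f (Sum.inl i)) else 0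

theorem tensorKetFun_elim (k : κ → ℕ) (ψ : (ι → ℕ) → ℂ) (n : ι → ℕ) :
    tensorKetFun k ψ (Sum.elim n k) = ψ n := by
  simp [tensorKetFun]

theorem tensorKetFun_eq_zero (k : κ → ℕ) (ψ : (ι → ℕ) → ℂ) (f : ι ⊕ κ → ℕ)
    (hf : f ∉ Set.range (fun n : ι → ℕ => (Sum.elim n k : ι ⊕ κ → ℕ))) :
    tensorKetFun k ψ f = 0 := by
  unfold tensorKetFun
  rw [if_neg]
  intro h
  refine hf ⟨fun i => f (Sum.inl i), ?_⟩
  funext x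
  cases x with
  | inl i => rfl
  | inr j => exact (congrFun h j).symm

theorem tensorKetFun_mem (k : κ → ℕ) (ψ : Fock ι) : Memℓp (tensorKetFun k ψ) 2 := by
  have h2 : (0 : ℝ) < (2 : ℝ≥0∞).toReal := by norm_num
  rw [memℓp_gen_iff h2, ← (elim_injective (ι := ι) k).summable_iff]
  · have h := (memℓp_gen_iff h2).1 (lp.memℓp ψ)
    simpa [Function.comp_def, tensorKetFun_elim] using h
  · intro f hf
    rw [tensorKetFun_eq_zero k ψ f hf]
    simp

/-- The isometry `ψ ↦ ψ ⊗ |k⟩` from `Fock ι` to `Fock (ι ⊕ κ)`. -/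
def tensorKet (k : κ → ℕ) : Fock ι →ₗᵢ[ℂ] Fock (ι ⊕ κ) where
  toFun ψ := ⟨tensorKetFun k ψ, tensorKetFun_mem k ψ⟩
  map_add' ψ φ := by
    ext f
    change tensorKetFun k (ψ + φ : Fock ι) f = tensorKetFun k ψ f + tensorKetFun k φ f
    by_cases h : (fun j => f (Sum.inr j)) = k <;> simp [tensorKetFun, h]
  map_smul' c ψ := by
    ext f
    change tensorKetFun k (c • ψ : Fock ι) f = c * tensorKetFun k ψ f
    by_cases h : (fun j => f (Sum.inr j)) = k <;> simp [tensorKetFun, h]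
  norm_map' ψ := by
    have h2 : (0 : ℝ) < (2 : ℝ≥0∞).toReal := by norm_num
    rw [lp.norm_eq_tsum_rpow h2, lp.norm_eq_tsum_rpow h2]
    congr 1
    rw [← (elim_injective (ι := ι) k).tsum_eq]
    · exact tsum_congr fun n => congrArg (fun z : ℂ => ‖z‖ ^ (2 : ℝ≥0∞).toReal)
        (tensorKetFun_elim k ψ n)
    · intro f hf
      by_contra hc
      apply hf
      change ‖tensorKetFun k ψ f‖ ^ (2 : ℝ≥0∞).toReal = 0
      rw [tensorKetFun_eq_zero k ψ f hc]
      simp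

end TensorKet

section Modes

variable {ι κ : Type} [Fintype ι] [DecidableEq ι] [Fintype κ] [DecidableEq κ]

/-- The occupation number state `|n⟩`. -/
def ket (n : ι → ℕ) : Fock ι := lp.single 2 n (1 : ℂ)

/-- The annihilation operator of mode `j` on coordinate functions:
`(a_j ψ)(n) = √(n_j + 1) ψ(n + δ_j)`, i.e. `a_j |n⟩ = √n_j |n - δ_j⟩`. -/
def annih (j : ι) (ψ : (ι → ℕ) → ℂ) : (ι → ℕ) → ℂ :=
  fun n => (Real.sqrt ((n j : ℝ) + 1) : ℂ) * ψ (n + Pi.single j 1)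

/-- The creation operator of mode `j` on coordinate functions:
`(a_j† ψ)(n) = √n_j ψ(n - δ_j)`, i.e. `a_j† |n⟩ = √(n_j + 1) |n + δ_j⟩`. -/
def creat (j : ι) (ψ : (ι → ℕ) → ℂ) : (ι → ℕ) → ℂ :=
  fun n => (Real.sqrt (n j : ℝ) : ℂ) * ψ (n - Pi.single j 1)

/-- The vector `ψ` has a finite mean total excitation number. These vectors form the domain of the
square root of the total number operator, which is the common domain of all `a_j`, `a_j†`. -/
def FiniteNumber (ψ : Fock ι) : Prop :=
  Summable fun n : ι → ℕ => (∑ j, (n j : ℝ)) * ‖ψ n‖ ^ 2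

/-- The unitary operator `W` is Gaussian: it acts on the mode operators by an affine Bogoliubov
transformation, `W† a_j W = ∑ k, (C j k a_k + S j k a_k†) + d j`. The two matrix conditions
express that the commutation relations are preserved. The operator identity is written in the form
`a_j W ψ = W (∑ k, (C j k a_k ψ + S j k a_k† ψ) + d j ψ)`. -/
def IsGaussian (W : Uni ι) : Prop :=
  ∃ (C S : Matrix ι ι ℂ) (d : ι → ℂ),
    C * C.conjTranspose - S * S.conjTranspose = 1 ∧
    C * S.transpose = S * C.transpose ∧
    ∀ ψ : Fock ι, FiniteNumber ψ →
      FiniteNumber (W ψ) ∧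
      ∀ (j : ι) (φ : Fock ι),
        (∀ n, φ n = ∑ k, (C j k * annih k ψ n + S j k * creat k ψ n) + d j * ψ n) →
        annih j (W ψ) = W φ

/-- The energy `∑ j, ω_j n_j` of the state `|n⟩`, for the Hamiltonian `H = ∑ j, ω_j a_j† a_j`. -/
def energy (ω : ι → ℝ) (n : ι → ℕ) : ℝ := ∑ j, ω j * n j

/-- The unitary operator `U` preserves the energy: `[U, H] = 0` for `H = ∑ j, ω_j a_j† a_j`.
For `ψ` in the domain of `H`, with `φ = H ψ`, also `U ψ` is in the domain and `H U ψ = U φ`. -/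
def EnergyPreserving (ω : ι → ℝ) (U : Uni ι) : Prop :=
  ∀ ψ φ : Fock ι, (∀ n, φ n = (energy ω n : ℂ) * ψ n) → ∀ n, (U φ) n = (energy ω n : ℂ) * (U ψ) n

/-! ### Gibbs states, tensor products, partial traces -/

/-- The Boltzmann weight `exp (- β E n) / Z` of `|n⟩`. -/
def gibbsWeight (β : ℝ) (ω : ι → ℝ) (n : ι → ℕ) : ℝ :=
  Real.exp (-β * energy ω n) / ∑' m : ι → ℕ, Real.exp (-β * energy ω m)

/-- The Gibbs state `exp (- β H) / tr exp (- β H)` of `H = ∑ j, ω_j a_j† a_j`. -/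
def gibbs (β : ℝ) (ω : ι → ℝ) : Op ι :=
  ∑' n : ι → ℕ, (gibbsWeight β ω n : ℂ) • InnerProductSpace.rankOne ℂ (ket n) (ket n)

/-- The conjugated operator `W T W†`. -/
def conj (W : Uni ι) (T : Op ι) : Op ι :=
  (W.toContinuousLinearEquiv : Op ι) ∘L T ∘L (W.symm.toContinuousLinearEquiv : Op ι)

/-- The state `ρ ⊗ τ` on `Fock (ι ⊕ κ)`, where `τ = ∑ k, p_k |k⟩⟨k|` is the Gibbs state of the
modes `κ`: the sum of the operators `p_k (1 ⊗ |k⟩) ρ (1 ⊗ ⟨k|)`. -/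
def tensorGibbs (β : ℝ) (ν : κ → ℝ) (ρ : Op ι) : Op (ι ⊕ κ) :=
  ∑' k : κ → ℕ, (gibbsWeight β ν k : ℂ) •
    ((tensorKet k).toContinuousLinearMap ∘L ρ ∘L
      ContinuousLinearMap.adjoint (tensorKet k : Fock ι →ₗᵢ[ℂ] Fock (ι ⊕ κ)).toContinuousLinearMap)

/-- The partial trace over the modes `κ`: `tr_κ T = ∑ k, (1 ⊗ ⟨k|) T (1 ⊗ |k⟩)`. The sum converges
in norm for every trace class operator `T`. -/
def ptrace (T : Op (ι ⊕ κ)) : Op ι :=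
  ∑' k : κ → ℕ,
    ContinuousLinearMap.adjoint (tensorKet k : Fock ι →ₗᵢ[ℂ] Fock (ι ⊕ κ)).toContinuousLinearMap ∘L
      T ∘L (tensorKet k).toContinuousLinearMap

/-! ### Thermal excitation and effective inverse temperature of a single mode -/

/-- The mean excitation number `tr (a† a T)` of a state `T` of one mode, computed in the basis of
eigenvectors of `a† a`. -/
def meanExcitation (T : Op Unit) : ℝ≥0∞ :=
  ∑' n : Unit → ℕ, (n () : ℝ≥0∞) * ENNReal.ofReal (T (ket n) n).re

/-- The thermal excitation: the minimum of `tr (a† a W ρ W†)` over the Gaussian unitaries `W`. -/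
def thermalExcitation (ρ : Op Unit) : ℝ≥0∞ :=
  ⨅ W : {W : Uni Unit // IsGaussian W}, meanExcitation (conj W.1 ρ)

/-- The effective inverse temperature `ω⁻¹ log ((𝔫 + 1) / 𝔫)`, where `𝔫` is the thermal excitation.
The argument of the logarithm is written as `1 + 𝔫⁻¹`, which gives the value `∞` for `𝔫 = 0` and
the value `0` for `𝔫 = ∞`. -/
def effInvTemp (ω : ℝ) (ρ : Op Unit) : EReal :=
  ((ω⁻¹ : ℝ) : EReal) * ENNReal.log (1 + (thermalExcitation ρ)⁻¹)

/-! ### SWAP and beam splitter -/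

/-- `V` is the SWAP of the modes `s` and `m`: it exchanges their occupation numbers. -/
def IsSwap (s m : ι) (V : Uni ι) : Prop :=
  ∀ n : ι → ℕ, V (ket n) = ket (n ∘ Equiv.swap s m)

/-- `V θ = exp (- i θ (a† b + a b†))`, where `a`, `b` are the annihilation operators of the modes
`s`, `m`: the strongly continuous one-parameter unitary group whose generator is given on the
occupation number states by `a† b + a b†`. -/
def IsBeamSplitterGroup (s m : ι) (V : ℝ → Uni ι) : Prop :=
  (∀ (θ θ' : ℝ) (ψ : Fock ι), V (θ + θ') ψ = V θ (V θ' ψ)) ∧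
  (∀ ψ : Fock ι, Continuous fun θ => V θ ψ) ∧
  ∀ (n : ι → ℕ) (φ : Fock ι),
    (∀ k, φ k = creat s (annih m (ket n)) k + annih s (creat m (ket n)) k) →
    HasDerivAt (fun θ => V θ (ket n)) (-Complex.I • φ) 0

end Modes

/-! ### Heat-bath algorithmic cooling -/

/-- The label of the target mode `S` and the `N` machine modes `M`. -/
abbrev SM (N : ℕ) : Type := Unit ⊕ Fin N

/-- The frequencies of the modes of `S` and `M`. -/
def freqSM {N : ℕ} (ω₀ : ℝ) (ω : Fin N → ℝ) : SM N → ℝ := Sum.elim (fun _ => ω₀) ω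

/-- One round of a protocol: a recharging unitary `V` on `S` and `M` and a thermalizing unitary `U`
on `S`, `M` and the `K` modes of the reservoir `R`. -/
structure Round (N K : ℕ) where
  V : Uni (SM N)
  U : Uni (SM N ⊕ Fin K)

/-- The state of `S` and `M` after one round: `tr_R [U (V ρ V† ⊗ τ_R) U†]`. -/
def Round.apply {N K : ℕ} (β : ℝ) (ν : Fin K → ℝ) (r : Round N K) (ρ : Op (SM N)) : Op (SM N) :=
  ptrace (conj r.U (tensorGibbs β ν (conj r.V ρ)))

/-- The final state of `S`, when the rounds of the protocol `P` are applied one after the other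
to the Gibbs state of `S` and `M`, with the reservoir in its Gibbs state in every round. -/
def outputS {N K : ℕ} (β ω₀ : ℝ) (ω : Fin N → ℝ) (ν : Fin K → ℝ) (P : List (Round N K)) : Op Unit :=
  ptrace (P.foldl (fun ρ r => r.apply β ν ρ) (gibbs β (freqSM ω₀ ω)))

/-- In every round of the protocol the recharging unitary is Gaussian and the thermalizing unitary
is Gaussian and energy-preserving. -/
def IsGaussianProtocol {N K : ℕ} (ω₀ : ℝ) (ω : Fin N → ℝ) (ν : Fin K → ℝ)
    (P : List (Round N K)) : Prop :=
  ∀ r ∈ P, IsGaussian r.V ∧ IsGaussian r.U ∧ EnergyPreserving (Sum.elim (freqSM ω₀ ω) ν) r.U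

/-- The protocol with a single round that consists of the recharging unitary `V` only. -/
def rechargeOnly {N : ℕ} (K : ℕ) (V : Uni (SM N)) : List (Round N K) :=
  [⟨V, LinearIsometryEquiv.refl ℂ _⟩]

end HBAC

end

open HBAC

open scoped ENNReal InnerProductSpace

noncomputable section

namespace HBAC

variable {ι : Type}

/-! ### Square sums of coordinate functions -/

/-! For an affine combination `A = ∑ (u k a_k + v k a_k†) + d` of the mode operators, the commutator
`[A, A†] = ∑ |u k|² - ∑ |v k|²` is a number. The upper bound rests on one invariant of a state `ρ`,
called `NumberBound c`: `tr (A† A ρ) ≥ c [A, A†]` for every such `A`. Here `c` is the thermal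
occupation number at the larger of `ω₀` and `ω_N`. Occupation numbers decrease with frequency, so
the initial Gibbs state satisfies the invariant. A Gaussian unitary maps the operators `A` to
operators of the same kind and preserves `[A, A†]` (`commutator_bogoliubov`), hence it preserves the
invariant. A partial trace only restricts the choice of `A`.

The delicate step is thermalization (`NumberBound.thermalize`): the reservoir may contain modes of
high frequency, whose occupation lies below `c`. However, an energy-preserving Gaussian unitary
mixes only modes of equal frequency and does not mix `a` with `a†` (`energyPreserving_coeff`). The
operators needed after the trace over the reservoir therefore have no component on those modes. At
the end, `A = a` gives mean excitation at least `c` after any Gaussian unitary on the target, so the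
thermal excitation is at least `c`, which bounds `β*`.

States are handled as sums `∑ |ψ i⟩⟨ψ i|` of vectors in the domain of the mode operators
(`IsEnsemble`). Then `tr (A† A ρ)` is `∑ ‖A ψ i‖²`, with values in `[0, ∞]`, and no unbounded
operator has to be multiplied with `ρ`.

For attainability, a unitary matrix on the modes is second quantized by linear substitution in
polynomials of creation operators. A permutation matrix gives the SWAP and a rotation gives the beam
splitter. The target then has excitation `∑ |C k|² n_k`, with `C` its row of the matrix and `n_k`
the initial occupations. For the beam splitter this interpolates continuously between the
occupations at `ω₀` and `ω_N`. -/

/-- The squared `ℓ²`-norm of a coordinate function, with values in `[0, ∞]`. -/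
def sqSum (f : (ι → ℕ) → ℂ) : ℝ≥0∞ := ∑' n, ‖f n‖ₑ ^ 2

theorem enorm_sq_eq_ofReal (z : ℂ) : ‖z‖ₑ ^ 2 = ENNReal.ofReal (‖z‖ ^ 2) := by
  rw [← ofReal_norm, ENNReal.ofReal_pow (norm_nonneg z)]

theorem sqSum_ne_top_iff (f : (ι → ℕ) → ℂ) :
    sqSum f ≠ ⊤ ↔ Summable fun n => ‖f n‖ ^ 2 := by
  have : sqSum f = ∑' n, ((‖f n‖₊ ^ 2 : NNReal) : ℝ≥0∞) := by
    simp [sqSum, enorm_eq_nnnorm]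
  rw [this, ENNReal.tsum_coe_ne_top_iff_summable, ← NNReal.summable_coe]
  simp

theorem memℓp_two_iff (f : (ι → ℕ) → ℂ) : Memℓp f 2 ↔ sqSum f ≠ ⊤ := by
  rw [sqSum_ne_top_iff, memℓp_gen_iff (by norm_num)]
  simp

theorem sqSum_coe (ψ : Fock ι) : sqSum ψ = ‖ψ‖ₑ ^ 2 := by
  have h2 : (0 : ℝ) < (2 : ℝ≥0∞).toReal := by norm_num
  have hs : Summable fun n => ‖ψ n‖ ^ 2 := (sqSum_ne_top_iff _).1 ((memℓp_two_iff _).1 (lp.memℓp ψ))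
  have h : ‖ψ‖ ^ 2 = ∑' n, ‖ψ n‖ ^ 2 := by
    have := lp.norm_rpow_eq_tsum h2 ψ
    simpa using this
  rw [← ofReal_norm, ← ENNReal.ofReal_pow (norm_nonneg _), h,
    ENNReal.ofReal_tsum_of_nonneg (fun n => by positivity) hs]
  exact tsum_congr fun n => enorm_sq_eq_ofReal _

theorem sqSum_smul (c : ℂ) (f : (ι → ℕ) → ℂ) : sqSum (fun n => c * f n) = ‖c‖ₑ ^ 2 * sqSum f := by
  simp [sqSum, enorm_mul, mul_pow, ENNReal.tsum_mul_left]

section Ket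

variable [Fintype ι]

theorem inner_ket_left (n : ι → ℕ) (ψ : Fock ι) : ⟪ket n, ψ⟫_ℂ = ψ n := by
  simpa [ket] using lp.inner_single_left (𝕜 := ℂ) (G := fun _ : ι → ℕ => ℂ) n (1 : ℂ) ψ

theorem ket_apply (n m : ι → ℕ) : ket n m = if m = n then 1 else 0 := by
  simp [ket, lp.single_apply, Pi.single_apply]

theorem finiteNumber_ket (n : ι → ℕ) : FiniteNumber (ket n) := by
  refine summable_of_ne_finset_zero (s := {n}) fun m hm => ?_
  simp [ket_apply, Finset.notMem_singleton.1 hm]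

end Ket

variable [DecidableEq ι]

theorem add_single_injective (j : ι) :
    Function.Injective fun n : ι → ℕ => n + Pi.single j 1 := fun _ _ h => add_right_cancel h

theorem sub_single_add_single {j : ι} {n : ι → ℕ} (h : n j ≠ 0) :
    n - Pi.single j 1 + Pi.single j 1 = n := by
  funext i
  by_cases hi : i = j
  · subst hi
    simp
    omega
  · simp [hi]

theorem add_single_sub_single (j : ι) (n : ι → ℕ) :
    n + Pi.single j 1 - Pi.single j 1 = n := by
  funext i
  simp

theorem mem_range_add_single {j : ι} {n : ι → ℕ} (h : n j ≠ 0) :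
    n ∈ Set.range fun n : ι → ℕ => n + Pi.single j 1 :=
  ⟨_, sub_single_add_single h⟩

theorem enorm_sqrt_sq {x : ℝ} (hx : 0 ≤ x) : ‖(Real.sqrt x : ℂ)‖ₑ ^ 2 = ENNReal.ofReal x := by
  rw [enorm_sq_eq_ofReal]
  simp [Real.sq_sqrt hx]

/-- Reindexing by `n ↦ n + δ_j` loses only the terms with `n j = 0`, which vanish. With values in
`[0, ∞]` no domain condition is needed. -/
theorem sqSum_annih (j : ι) (f : (ι → ℕ) → ℂ) :
    sqSum (annih j f) = ∑' n, (n j : ℝ≥0∞) * ‖f n‖ₑ ^ 2 := by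
  rw [← (add_single_injective j).tsum_eq]
  · refine tsum_congr fun n => ?_
    simp only [annih, enorm_mul, mul_pow]
    rw [enorm_sqrt_sq (by positivity), ENNReal.ofReal_add (by positivity) zero_le_one]
    simp
  · intro n hn
    refine mem_range_add_single fun h => hn ?_
    simp [h]

theorem sqSum_creat (j : ι) (f : (ι → ℕ) → ℂ) :
    sqSum (creat j f) = ∑' n, ((n j : ℝ≥0∞) + 1) * ‖f n‖ₑ ^ 2 := by
  rw [sqSum, ← (add_single_injective j).tsum_eq]
  · refine tsum_congr fun n => ?_
    simp only [creat, enorm_mul, mul_pow, add_single_sub_single]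
    rw [enorm_sqrt_sq (by positivity)]
    simp [ENNReal.ofReal_add]
  · intro n hn
    refine mem_range_add_single fun h => hn ?_
    simp [creat, h]

/-- The commutation relation `a a† = a† a + 1` as an identity of norms; it shows that `a_j` and
`a_j†` have the same domain. -/
theorem sqSum_creat_eq (j : ι) (f : (ι → ℕ) → ℂ) :
    sqSum (creat j f) = sqSum (annih j f) + sqSum f := by
  rw [sqSum_creat, sqSum_annih, sqSum, ← ENNReal.tsum_add]
  exact tsum_congr fun n => by ring

/-- The shift by `δ_j` matches the two series term by term, so adjointness requires no summability.
-/
theorem tsum_star_annih_mul (j : ι) (f g : (ι → ℕ) → ℂ) :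
    ∑' n, g n * star (annih j f n) = ∑' n, creat j g n * star (f n) := by
  rw [← (add_single_injective j).tsum_eq (f := fun n => creat j g n * star (f n))]
  · refine tsum_congr fun n => ?_
    simp only [creat, add_single_sub_single]
    simp [annih]
    ring
  · intro n hn
    refine mem_range_add_single fun h => hn ?_
    simp [creat, h]

theorem inner_annih_left (j : ι) {χ χ' ψ ψ' : Fock ι} (hχ : ∀ n, χ' n = annih j χ n)
    (hψ : ∀ n, ψ' n = creat j ψ n) : ⟪χ', ψ⟫_ℂ = ⟪χ, ψ'⟫_ℂ := by
  rw [lp.inner_eq_tsum, lp.inner_eq_tsum]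
  have := tsum_star_annih_mul j χ ψ
  simpa [hχ, hψ] using this

variable [Fintype ι]

theorem finiteNumber_iff (ψ : Fock ι) : FiniteNumber ψ ↔ ∀ j, sqSum (annih j ψ) ≠ ⊤ := by
  have h : ∀ j, sqSum (annih j ψ) ≠ ⊤ ↔ Summable fun n : ι → ℕ => (n j : ℝ) * ‖ψ n‖ ^ 2 := by
    intro j
    have : sqSum (annih j ψ) = ∑' n : ι → ℕ, (((n j : NNReal) * ‖ψ n‖₊ ^ 2 : NNReal) : ℝ≥0∞) := by
      simp [sqSum_annih, enorm_eq_nnnorm]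
    rw [this, ENNReal.tsum_coe_ne_top_iff_summable, ← NNReal.summable_coe]
    simp
  simp only [h, FiniteNumber, Finset.sum_mul]
  constructor
  · intro hs j
    refine Summable.of_nonneg_of_le (fun n => by positivity) (fun n => ?_) hs
    exact Finset.single_le_sum (f := fun j => (n j : ℝ) * ‖ψ n‖ ^ 2)
      (fun i _ => by positivity) (Finset.mem_univ j)
  · exact fun hs => summable_sum fun j _ => hs j

theorem FiniteNumber.memℓp_annih {ψ : Fock ι} (h : FiniteNumber ψ) (j : ι) :
    Memℓp (annih j ψ) 2 := (memℓp_two_iff _).2 ((finiteNumber_iff ψ).1 h j)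

theorem FiniteNumber.memℓp_creat {ψ : Fock ι} (h : FiniteNumber ψ) (j : ι) :
    Memℓp (creat j ψ) 2 := by
  rw [memℓp_two_iff, sqSum_creat_eq]
  exact ENNReal.add_ne_top.2 ⟨(finiteNumber_iff ψ).1 h j, (memℓp_two_iff _).1 (lp.memℓp ψ)⟩

/-! ### Affine combinations of the mode operators -/

/-- The operator `∑ k, (u k a_k + v k a_k†) + d` on coordinate functions. -/
def linOp (u v : ι → ℂ) (d : ℂ) (f : (ι → ℕ) → ℂ) : (ι → ℕ) → ℂ :=
  fun n => ∑ k, (u k * annih k f n + v k * creat k f n) + d * f n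

theorem FiniteNumber.memℓp_linOp {ψ : Fock ι} (h : FiniteNumber ψ) (u v : ι → ℂ) (d : ℂ) :
    Memℓp (linOp u v d ψ) 2 := by
  have h1 : Memℓp (fun n => ∑ k, (u k * annih k ψ n + v k * creat k ψ n)) 2 :=
    Memℓp.finsetSum (E := fun _ : ι → ℕ => ℂ) Finset.univ
      (f := fun k n => u k * annih k ψ n + v k * creat k ψ n) fun k _ =>
      ((h.memℓp_annih k).const_mul (u k)).add ((h.memℓp_creat k).const_mul (v k))
  exact h1.add ((lp.memℓp ψ).const_mul d)

/-- The vector `(∑ k, (u k a_k + v k a_k†) + d) ψ`. -/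
def linVec (u v : ι → ℂ) (d : ℂ) (ψ : Fock ι) (h : FiniteNumber ψ) : Fock ι :=
  ⟨linOp u v d ψ, h.memℓp_linOp u v d⟩

@[simp] theorem linVec_apply (u v : ι → ℂ) (d : ℂ) (ψ : Fock ι) (h : FiniteNumber ψ)
    (n : ι → ℕ) : linVec u v d ψ h n = linOp u v d ψ n := rfl

end HBAC

namespace HBAC

variable {ι : Type} [Fintype ι]

theorem dotProduct_star_self (u : ι → ℂ) : u ⬝ᵥ star u = ((∑ k, ‖u k‖ ^ 2 : ℝ) : ℂ) := by
  simp [dotProduct, Complex.mul_conj, Complex.normSq_eq_norm_sq]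

variable [DecidableEq ι]

/-! ### Gaussian unitaries acting on affine combinations of the mode operators -/

theorem linVec_eq_sum (u v : ι → ℂ) (d : ℂ) (ψ : Fock ι) (h : FiniteNumber ψ) :
    linVec u v d ψ h = ∑ k, (u k • (⟨annih k ψ, h.memℓp_annih k⟩ : Fock ι) +
      v k • (⟨creat k ψ, h.memℓp_creat k⟩ : Fock ι)) + d • ψ := by
  ext n
  simp only [linVec_apply, linOp, lp.coeFn_add, lp.coeFn_sum, lp.coeFn_smul, Pi.add_apply,
    Finset.sum_apply, Pi.smul_apply, smul_eq_mul]

/-- Taking the adjoint of `A` conjugates the coefficients and exchanges the roles of `u` and `v`. -/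
theorem inner_linVec_left (u v : ι → ℂ) (d : ℂ) {χ ψ : Fock ι} (hχ : FiniteNumber χ)
    (hψ : FiniteNumber ψ) :
    ⟪linVec u v d χ hχ, ψ⟫_ℂ =
      ⟪χ, linVec (fun k => star (v k)) (fun k => star (u k)) (star d) ψ hψ⟫_ℂ := by
  simp only [linVec_eq_sum, inner_add_left, inner_add_right, sum_inner, inner_sum, inner_smul_left,
    inner_smul_right]
  congr 1
  refine Finset.sum_congr rfl fun k _ => ?_
  rw [inner_annih_left k (χ := χ) (ψ := ψ) (ψ' := ⟨creat k ψ, hψ.memℓp_creat k⟩)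
    (fun _ => rfl) (fun _ => rfl), ← inner_conj_symm (⟨creat k χ, hχ.memℓp_creat k⟩ : Fock ι) ψ,
    ← inner_annih_left k (χ := ψ) (ψ := χ) (χ' := ⟨annih k ψ, hψ.memℓp_annih k⟩)
    (fun _ => rfl) (fun _ => rfl), inner_conj_symm]
  simp only [starRingEnd_apply]
  ring

/-- The affine Bogoliubov transformation with the matrices `C`, `S` and the displacement `d`
describes the action of the unitary operator `W` on the annihilation operators. -/
def Implements (W : Uni ι) (C S : Matrix ι ι ℂ) (d : ι → ℂ) : Prop :=
  ∀ (ψ : Fock ι) (h : FiniteNumber ψ), FiniteNumber (W ψ) ∧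
    ∀ j, annih j (W ψ) = W (linVec (C j) (S j) (d j) ψ h)

theorem isGaussian_iff (W : Uni ι) : IsGaussian W ↔ ∃ (C S : Matrix ι ι ℂ) (d : ι → ℂ),
    C * C.conjTranspose - S * S.conjTranspose = 1 ∧ C * S.transpose = S * C.transpose ∧
    Implements W C S d := by
  refine exists_congr fun C => exists_congr fun S => exists_congr fun d =>
    and_congr_right fun _ => and_congr_right fun _ => ?_
  constructor
  · exact fun H ψ h => ⟨(H ψ h).1, fun j => (H ψ h).2 j _ fun _ => rfl⟩
  · intro H ψ h
    refine ⟨(H ψ h).1, fun j φ hφ => ?_⟩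
    rw [(H ψ h).2 j]
    congr 2
    ext n
    exact (hφ n).symm

namespace Implements

variable {W : Uni ι} {C S : Matrix ι ι ℂ} {d : ι → ℂ}

/-- The hypothesis concerns the annihilation operators only. The rule for the creation operators
follows by adjointness, testing against the vectors `W |n⟩`. -/
theorem creat_apply (H : Implements W C S d) {ψ : Fock ι} (h : FiniteNumber ψ) (j : ι) :
    creat j (W ψ) = W (linVec (fun k => star (S j k)) (fun k => star (C j k)) (star (d j)) ψ h) := by
  set c : Fock ι := ⟨creat j (W ψ), (H ψ h).1.memℓp_creat j⟩
  suffices hc : W.symm c =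
      linVec (fun k => star (S j k)) (fun k => star (C j k)) (star (d j)) ψ h by
    rw [← hc, W.apply_symm_apply]
  ext n
  have hn := H (ket n) (finiteNumber_ket n)
  have e : ⟪W (linVec (C j) (S j) (d j) (ket n) (finiteNumber_ket n)), W ψ⟫_ℂ = ⟪W (ket n), c⟫_ℂ :=
    inner_annih_left j (fun m => by rw [hn.2 j]) fun _ => rfl
  rw [← inner_ket_left n (W.symm c), ← inner_ket_left,
    ← inner_linVec_left (C j) (S j) (d j) (finiteNumber_ket n) h, ← W.inner_map_map (ket n),
    W.apply_symm_apply, ← e, W.inner_map_map]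

theorem linOp_apply (H : Implements W C S d) {ψ : Fock ι} (h : FiniteNumber ψ) (u v : ι → ℂ)
    (e : ℂ) :
    linOp u v e (W ψ) = W (linVec (fun k => ∑ j, (u j * C j k + v j * star (S j k)))
      (fun k => ∑ j, (u j * S j k + v j * star (C j k)))
      (e + ∑ j, (u j * d j + v j * star (d j))) ψ h) := by
  have key : linVec (fun k => ∑ j, (u j * C j k + v j * star (S j k)))
      (fun k => ∑ j, (u j * S j k + v j * star (C j k)))
      (e + ∑ j, (u j * d j + v j * star (d j))) ψ h =
      ∑ j, (u j • linVec (C j) (S j) (d j) ψ h +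
        v j • linVec (fun k => star (S j k)) (fun k => star (C j k)) (star (d j)) ψ h) + e • ψ := by
    ext n
    simp only [linVec_apply, linOp, lp.coeFn_add, lp.coeFn_sum, lp.coeFn_smul, Pi.add_apply,
      Finset.sum_apply, Pi.smul_apply, smul_eq_mul, mul_add, Finset.mul_sum, Finset.sum_add_distrib,
      add_mul, Finset.sum_mul]
    rw [Finset.sum_comm (f := fun k j => u j * C j k * annih k ψ n),
      Finset.sum_comm (f := fun k j => v j * star (S j k) * annih k ψ n),
      Finset.sum_comm (f := fun k j => u j * S j k * creat k ψ n),
      Finset.sum_comm (f := fun k j => v j * star (C j k) * creat k ψ n)]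
    simp only [mul_assoc]
    ring
  rw [key]
  funext n
  simp only [linOp, (H ψ h).2, H.creat_apply h, map_add, map_sum, map_smul, lp.coeFn_add,
    lp.coeFn_sum, lp.coeFn_smul, Pi.add_apply, Finset.sum_apply, Pi.smul_apply, smul_eq_mul]

/-- Once `A` has been moved through `W`, the isometry `W` drops out of the norm. Gaussian unitaries
thus enter the moments only through this change of coefficients. -/
theorem sqSum_linOp (H : Implements W C S d) {ψ : Fock ι} (h : FiniteNumber ψ) (u v : ι → ℂ)
    (e : ℂ) :
    sqSum (linOp u v e (W ψ)) = sqSum (linOp (fun k => ∑ j, (u j * C j k + v j * star (S j k)))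
      (fun k => ∑ j, (u j * S j k + v j * star (C j k)))
      (e + ∑ j, (u j * d j + v j * star (d j))) ψ) := by
  rw [H.linOp_apply h, sqSum_coe, ← ofReal_norm, W.norm_map, ofReal_norm, ← sqSum_coe]
  rfl

end Implements

open Matrix in
/-- Bogoliubov transformations preserve the commutator `[A, A†]` of `A = ∑ k, (u k a_k + v k a_k†)`. -/
theorem commutator_bogoliubov {C S : Matrix ι ι ℂ}
    (h1 : C * C.conjTranspose - S * S.conjTranspose = 1)
    (h2 : C * S.transpose = S * C.transpose) (u v : ι → ℂ) :
    ∑ k, ‖∑ j, (u j * C j k + v j * star (S j k))‖ ^ 2 -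
      ∑ k, ‖∑ j, (u j * S j k + v j * star (C j k))‖ ^ 2 =
    ∑ k, ‖u k‖ ^ 2 - ∑ k, ‖v k‖ ^ 2 := by
  have e1 : (fun k => ∑ j, (u j * C j k + v j * star (S j k))) = u ᵥ* C + v ᵥ* Sᴴᵀ := by
    funext k
    simp [vecMul, dotProduct, Finset.sum_add_distrib]
  have e2 : (fun k => ∑ j, (u j * S j k + v j * star (C j k))) = u ᵥ* S + v ᵥ* Cᴴᵀ := by
    funext k
    simp [vecMul, dotProduct, Finset.sum_add_distrib]
  -- Expanding both squared norms leaves products of `C` and `S`. The hypotheses and their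
  -- transposed or conjugated forms `h3`, `h4` cancel the mixed terms and reduce the others to
  -- identity matrices.
  have h1' : C * Cᴴ = 1 + S * Sᴴ := by rw [← h1]; abel
  have h3 : Cᴴᵀ * Cᵀ = 1 + Sᴴᵀ * Sᵀ := by
    have := congrArg transpose h1'
    simpa [transpose_mul] using this
  have h4 : Sᴴᵀ * Cᴴ = Cᴴᵀ * Sᴴ := by
    have := congrArg (fun M => Mᴴᵀ) h2
    simp only [conjTranspose_mul, transpose_mul] at this
    exact this.symm
  have g : ∀ M : Matrix ι ι ℂ, (Mᴴᵀ)ᴴ = Mᵀ := fun M => by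
    ext
    simp
  have hC : ((∑ k, ‖∑ j, (u j * C j k + v j * star (S j k))‖ ^ 2 : ℝ) : ℂ) -
      ((∑ k, ‖∑ j, (u j * S j k + v j * star (C j k))‖ ^ 2 : ℝ) : ℂ) =
      ((∑ k, ‖u k‖ ^ 2 : ℝ) : ℂ) - ((∑ k, ‖v k‖ ^ 2 : ℝ) : ℂ) := by
    rw [← dotProduct_star_self (fun k => ∑ j, (u j * C j k + v j * star (S j k))),
      ← dotProduct_star_self (fun k => ∑ j, (u j * S j k + v j * star (C j k))),
      ← dotProduct_star_self, ← dotProduct_star_self, e1, e2]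
    simp only [star_add, star_vecMul, g, add_dotProduct, dotProduct_add]
    simp only [← dotProduct_mulVec, mulVec_mulVec, h1', h2, h3, h4, add_mulVec, one_mulVec,
      dotProduct_add]
    ring
  exact_mod_cast hC

end HBAC

namespace HBAC

/-! ### Thermal occupation numbers -/

/-- The mean excitation number `1 / (exp (β ω) - 1)` of a mode of frequency `ω` in its Gibbs
state. -/
def occ (β ω : ℝ) : ℝ := (Real.exp (β * ω) - 1)⁻¹

section Occ

variable {β ω : ℝ}

theorem occ_pos (h : 0 < β * ω) : 0 < occ β ω := by
  have := Real.one_lt_exp_iff.2 h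
  rw [occ]
  exact inv_pos.2 (by linarith)

theorem occ_anti {ω' : ℝ} (hβ : 0 < β) (h : 0 < ω) (h' : ω ≤ ω') : occ β ω' ≤ occ β ω := by
  have h1 := Real.one_lt_exp_iff.2 (mul_pos hβ h)
  have h2 := Real.exp_le_exp.2 (mul_le_mul_of_nonneg_left h' hβ.le)
  exact inv_anti₀ (by linarith) (by linarith)

theorem occ_eq (h : 0 < β * ω) : occ β ω = Real.exp (-(β * ω)) / (1 - Real.exp (-(β * ω))) := by
  have h1 := Real.one_lt_exp_iff.2 h
  have h2 : Real.exp (β * ω) - 1 ≠ 0 := by linarith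
  rw [occ, Real.exp_neg]
  have h3 := Real.exp_pos (β * ω)
  field_simp

end Occ

variable {ι : Type} [Fintype ι]

theorem energy_add (ω : ι → ℝ) (n m : ι → ℕ) : energy ω (n + m) = energy ω n + energy ω m := by
  simp [energy, mul_add, Finset.sum_add_distrib]

/-- The weights are products of geometric weights. Every finite set of occupation numbers lies in a
box, where the sum factorizes and is bounded by the product of the full geometric series. -/
theorem summable_boltzmann {β : ℝ} (hβ : 0 < β) {ω : ι → ℝ} (hω : ∀ j, 0 < ω j) :
    Summable fun n : ι → ℕ => Real.exp (-β * energy ω n) := by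
  classical
  have hx : ∀ j, Real.exp (-(β * ω j)) < 1 := fun j =>
    Real.exp_lt_one_iff.2 (neg_neg_of_pos (mul_pos hβ (hω j)))
  have hf : ∀ n : ι → ℕ, Real.exp (-β * energy ω n) = ∏ j, Real.exp (-(β * ω j)) ^ n j := by
    intro n
    simp only [energy, ← Real.exp_nat_mul, ← Real.exp_sum, Finset.mul_sum]
    exact congrArg Real.exp (Finset.sum_congr rfl fun j _ => by ring)
  simp only [hf]
  refine summable_of_sum_le (c := ∏ j, (1 - Real.exp (-(β * ω j)))⁻¹) (fun n => by positivity)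
    fun s => ?_
  let M := s.sup fun n => Finset.univ.sup n
  have hs : s ⊆ Fintype.piFinset fun _ : ι => Finset.range (M + 1) := by
    intro n hn
    refine Fintype.mem_piFinset.2 fun j => Finset.mem_range.2 (Nat.lt_succ_of_le ?_)
    exact (Finset.le_sup (f := n) (Finset.mem_univ j)).trans
      (Finset.le_sup (f := fun n : ι → ℕ => Finset.univ.sup n) hn)
  refine (Finset.sum_le_sum_of_subset_of_nonneg hs fun n _ _ => by positivity).trans ?_
  rw [← Finset.prod_univ_sum (fun _ => Finset.range (M + 1))
    fun j k => Real.exp (-(β * ω j)) ^ k]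
  refine Finset.prod_le_prod (fun j _ => Finset.sum_nonneg fun k _ => by positivity) fun j _ => ?_
  have h0 := (Real.exp_pos (-(β * ω j))).le
  rw [← tsum_geometric_of_lt_one h0 (hx j)]
  exact (summable_geometric_of_lt_one h0 (hx j)).sum_le_tsum _ fun k _ => by positivity

variable {β : ℝ} {ω : ι → ℝ}

theorem partition_pos (hβ : 0 < β) (hω : ∀ j, 0 < ω j) :
    0 < ∑' m : ι → ℕ, Real.exp (-β * energy ω m) :=
  (summable_boltzmann hβ hω).tsum_pos (fun _ => (Real.exp_pos _).le) 0 (Real.exp_pos _)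

theorem gibbsWeight_nonneg (n : ι → ℕ) : 0 ≤ gibbsWeight β ω n :=
  div_nonneg (Real.exp_pos _).le (tsum_nonneg fun _ => (Real.exp_pos _).le)

theorem summable_gibbsWeight (hβ : 0 < β) (hω : ∀ j, 0 < ω j) :
    Summable (gibbsWeight β ω) := (summable_boltzmann hβ hω).div_const _

theorem tsum_gibbsWeight (hβ : 0 < β) (hω : ∀ j, 0 < ω j) :
    ∑' n, ENNReal.ofReal (gibbsWeight β ω n) = 1 := by
  rw [← ENNReal.ofReal_tsum_of_nonneg gibbsWeight_nonneg (summable_gibbsWeight hβ hω)]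
  simp only [gibbsWeight, tsum_div_const]
  rw [div_self (partition_pos hβ hω).ne', ENNReal.ofReal_one]

variable [DecidableEq ι]

theorem gibbsWeight_add_single (j : ι) (n : ι → ℕ) :
    gibbsWeight β ω (n + Pi.single j 1) = Real.exp (-(β * ω j)) * gibbsWeight β ω n := by
  have h : energy ω (Pi.single j 1 : ι → ℕ) = ω j := by
    simp [energy, Pi.single_apply]
  rw [gibbsWeight, gibbsWeight, energy_add, h, mul_add, Real.exp_add]
  ring_nf

/-- Half of the energy of mode `j` is spent on absorbing the factor `n j`, through `x exp (-x) ≤ 1`.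
What remains is a Boltzmann weight with `ω j` halved. -/
theorem summable_mul_gibbsWeight (hβ : 0 < β) (hω : ∀ j, 0 < ω j) (j : ι) :
    Summable fun n : ι → ℕ => (n j : ℝ) * gibbsWeight β ω n := by
  have hbj := mul_pos hβ (hω j)
  have hω' : ∀ i, 0 < Function.update ω j (ω j / 2) i := by
    intro i
    by_cases h : i = j
    · subst h
      simpa using hω i
    · simpa [h] using hω i
  have hE : ∀ n : ι → ℕ, energy ω n = energy (Function.update ω j (ω j / 2)) n + ω j / 2 * n j := by
    intro n
    simp only [energy]
    rw [Fintype.sum_eq_add_sum_compl j, Fintype.sum_eq_add_sum_compl j]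
    have : ∑ i ∈ {j}ᶜ, Function.update ω j (ω j / 2) i * (n i : ℝ) = ∑ i ∈ {j}ᶜ, ω i * (n i : ℝ) := by
      refine Finset.sum_congr rfl fun i hi => ?_
      rw [Function.update_of_ne (by simpa using hi)]
    rw [this, Function.update_self]
    ring
  simp only [gibbsWeight, ← mul_div_assoc]
  refine Summable.div_const ?_ _
  refine Summable.of_nonneg_of_le (fun n => by positivity) (fun n => ?_)
    ((summable_boltzmann hβ hω').mul_left (2 / (β * ω j)))
  have h1 : β * ω j / 2 * n j ≤ Real.exp (β * ω j / 2 * n j) := by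
    linarith [Real.add_one_le_exp (β * ω j / 2 * n j)]
  have h2 : -β * energy ω n =
      -β * energy (Function.update ω j (ω j / 2)) n + -(β * ω j / 2 * n j) := by
    rw [hE n]
    ring
  have h3 : (β * ω j / 2 * n j) * (Real.exp (β * ω j / 2 * n j))⁻¹ ≤ 1 := by
    rw [← div_eq_mul_inv]
    exact (div_le_one (Real.exp_pos _)).2 h1
  have hn : (n j : ℝ) = 2 / (β * ω j) * (β * ω j / 2 * n j) := by
    have := hω j
    field_simp
  rw [h2, Real.exp_add, Real.exp_neg]
  have h4 := mul_le_mul_of_nonneg_left h3 (mul_nonneg (div_nonneg zero_le_two hbj.le)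
    (Real.exp_pos (-β * energy (Function.update ω j (ω j / 2)) n)).le)
  refine le_trans (le_of_eq ?_) (h4.trans_eq (mul_one _))
  nth_rewrite 1 [hn]
  ring

theorem tsum_mul_gibbsWeight (hβ : 0 < β) (hω : ∀ j, 0 < ω j) (j : ι) :
    ∑' n : ι → ℕ, (n j : ℝ≥0∞) * ENNReal.ofReal (gibbsWeight β ω n) =
      ENNReal.ofReal (occ β (ω j)) := by
  have hs := summable_mul_gibbsWeight hβ hω j
  have hs1 := summable_gibbsWeight hβ hω
  have h1 : ∑' n, gibbsWeight β ω n = 1 := by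
    have := tsum_gibbsWeight hβ hω
    rw [← ENNReal.ofReal_tsum_of_nonneg gibbsWeight_nonneg hs1] at this
    simpa using this
  have hx : Real.exp (-(β * ω j)) < 1 :=
    Real.exp_lt_one_iff.2 (neg_neg_of_pos (mul_pos hβ (hω j)))
  -- The shift by `δ_j` multiplies the weight by `x = exp (-β ω_j)`, so the mean `m` solves `m = x
  -- (m + 1)`.
  have hrec : ∑' n : ι → ℕ, (n j : ℝ) * gibbsWeight β ω n =
      Real.exp (-(β * ω j)) * (∑' n : ι → ℕ, (n j : ℝ) * gibbsWeight β ω n + 1) := by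
    conv_lhs => rw [← (add_single_injective j).tsum_eq (by
      intro n hn
      exact mem_range_add_single fun h => hn (by simp [h]))]
    rw [← h1, ← hs.tsum_add hs1, ← tsum_mul_left]
    refine tsum_congr fun n => ?_
    rw [gibbsWeight_add_single]
    simp
    ring
  have hval : ∑' n : ι → ℕ, (n j : ℝ) * gibbsWeight β ω n = occ β (ω j) := by
    rw [occ_eq (mul_pos hβ (hω j)), eq_div_iff (by linarith)]
    linarith
  rw [← hval, ENNReal.ofReal_tsum_of_nonneg
    (fun n => mul_nonneg (Nat.cast_nonneg _) (gibbsWeight_nonneg n)) hs]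
  refine tsum_congr fun n => ?_
  rw [ENNReal.ofReal_mul (Nat.cast_nonneg _), ENNReal.ofReal_natCast]

end HBAC

namespace HBAC

/-! ### Mode operators on occupation number states -/

theorem enorm_sum_sq_of_disjoint {τ : Type*} [Fintype τ] (z : τ → ℂ)
    (h : ∀ s t, s ≠ t → z s = 0 ∨ z t = 0) : ‖∑ t, z t‖ₑ ^ 2 = ∑ t, ‖z t‖ₑ ^ 2 := by
  by_cases hz : ∀ t, z t = 0
  · simp [hz]
  · push Not at hz
    obtain ⟨t, ht⟩ := hz
    have h0 : ∀ s, s ≠ t → z s = 0 := fun s hs => (h s t hs).resolve_right ht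
    rw [Fintype.sum_eq_single t h0, Fintype.sum_eq_single t fun s hs => by simp [h0 s hs]]

section Ket

variable {ι : Type} [Fintype ι]

theorem tsum_mul_enorm_ket (g : (ι → ℕ) → ℝ≥0∞) (k : ι → ℕ) :
    ∑' n, g n * ‖ket k n‖ₑ ^ 2 = g k := by
  rw [tsum_eq_single k]
  · simp [ket_apply]
  · intro n hn
    simp [ket_apply, hn]

theorem sqSum_ket (k : ι → ℕ) : sqSum (ket k) = 1 := by
  simpa [sqSum] using tsum_mul_enorm_ket (fun _ => 1) k

variable [DecidableEq ι]

theorem annih_ket_apply (j : ι) (k n : ι → ℕ) :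
    annih j (ket k) n = if n + Pi.single j 1 = k then (Real.sqrt (k j) : ℂ) else 0 := by
  simp only [annih, ket_apply]
  split_ifs with h
  · simp [← h]
  · simp

theorem creat_ket_apply (j : ι) (k n : ι → ℕ) :
    creat j (ket k) n = if n = k + Pi.single j 1 then (Real.sqrt (k j + 1) : ℂ) else 0 := by
  simp only [creat, ket_apply]
  by_cases hj : n j = 0
  · have : n ≠ k + Pi.single j 1 := fun h => by simp [h] at hj
    simp [hj, this]
  · have : n - Pi.single j 1 = k ↔ n = k + Pi.single j 1 :=
      ⟨fun h => by rw [← h, sub_single_add_single hj],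
        fun h => by rw [h, add_single_sub_single]⟩
    simp only [this]
    split_ifs with h
    · simp [h]
    · simp

/-- The vectors `a_r |k⟩`, `a_r† |k⟩` and `|k⟩` are multiples of distinct occupation number states,
so the squared norms add up. In `z`, the index `none` labels the constant term and the two summands
label annihilation and creation. -/
theorem sqSum_linOp_ket (u v : ι → ℂ) (d : ℂ) (k : ι → ℕ) :
    sqSum (linOp u v d (ket k)) =
      ∑ r, (‖u r‖ₑ ^ 2 * k r + ‖v r‖ₑ ^ 2 * (k r + 1)) + ‖d‖ₑ ^ 2 := by
  let z : (ι → ℕ) → Option (ι ⊕ ι) → ℂ := fun n t => t.elim (d * ket k n)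
    (Sum.elim (fun r => u r * annih r (ket k) n) fun r => v r * creat r (ket k) n)
  have hsingle : ∀ (n : ι → ℕ) (r s : ι), n + Pi.single r 1 = n + Pi.single s 1 → r = s := by
    intro n r s h
    have := congrFun (add_left_cancel h) r
    by_contra hrs
    simp [hrs] at this
  have hne : ∀ (n : ι → ℕ) (r : ι), n + Pi.single r 1 ≠ n := by
    intro n r h
    simpa using congrFun h r
  have hne2 : ∀ (n : ι → ℕ) (r s : ι), n + Pi.single s 1 + Pi.single r 1 ≠ n := by
    intro n r s h
    have := congrFun h r
    simp only [Pi.add_apply, Pi.single_eq_same] at this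
    omega
  have hz : ∀ n s t, s ≠ t → z n s = 0 ∨ z n t = 0 := by
    intro n s t hst
    by_contra! hc
    obtain ⟨h1, h2⟩ := hc
    rcases s with _ | s | s <;> rcases t with _ | t | t <;>
      simp only [z, Option.elim, Sum.elim_inl, Sum.elim_inr, annih_ket_apply, creat_ket_apply,
        ket_apply, ne_eq, mul_eq_zero, ite_eq_right_iff, not_or, Classical.not_imp] at h1 h2
    · exact hst rfl
    · exact hne _ _ (h2.2.1.trans h1.2.1.symm)
    · exact hne _ _ (h2.2.1.symm.trans h1.2.1)
    · exact hne _ _ (h1.2.1.trans h2.2.1.symm)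
    · exact hst (by rw [hsingle n s t (h1.2.1.trans h2.2.1.symm)])
    · exact hne2 k s t (by rw [← h2.2.1]; exact h1.2.1)
    · exact hne _ _ (h1.2.1.symm.trans h2.2.1)
    · exact hne2 k t s (by rw [← h1.2.1]; exact h2.2.1)
    · exact hst (by rw [hsingle k s t (h1.2.1.symm.trans h2.2.1)])
  have hsum : ∀ n, linOp u v d (ket k) n = ∑ t, z n t := by
    intro n
    simp [z, linOp, Fintype.sum_option, Finset.sum_add_distrib, add_comm]
  simp only [sqSum, hsum, enorm_sum_sq_of_disjoint _ (hz _)]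
  rw [Summable.tsum_finsetSum fun _ _ => ENNReal.summable]
  have h1 : ∀ r, ∑' n, ‖u r * annih r (ket k) n‖ₑ ^ 2 = ‖u r‖ₑ ^ 2 * k r := fun r => by
    have := sqSum_smul (u r) (annih r (ket k))
    rwa [sqSum_annih, tsum_mul_enorm_ket fun n => (n r : ℝ≥0∞)] at this
  have h2 : ∀ r, ∑' n, ‖v r * creat r (ket k) n‖ₑ ^ 2 = ‖v r‖ₑ ^ 2 * (k r + 1) := fun r => by
    have := sqSum_smul (v r) (creat r (ket k))
    rwa [sqSum_creat, tsum_mul_enorm_ket fun n => ((n r : ℝ≥0∞) + 1)] at this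
  have h3 : ∑' n, ‖d * ket k n‖ₑ ^ 2 = ‖d‖ₑ ^ 2 := by
    have := sqSum_smul d (ket k)
    rwa [sqSum_ket, mul_one] at this
  simp only [z, Fintype.sum_option, Fintype.sum_sum_type, Option.elim, Sum.elim_inl, Sum.elim_inr,
    h1, h2, h3, Finset.sum_add_distrib]
  ring

/-- The thermal expectation value of `A† A` for `A = ∑ k, (u k a_k + v k a_k†)`. -/
def thermalMoment (β : ℝ) (ω : ι → ℝ) (u v : ι → ℂ) : ℝ≥0∞ :=
  ∑ r, (‖u r‖ₑ ^ 2 * ENNReal.ofReal (occ β (ω r)) +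
    ‖v r‖ₑ ^ 2 * (ENNReal.ofReal (occ β (ω r)) + 1))

theorem tsum_gibbsWeight_mul_sqSum {β : ℝ} {ω : ι → ℝ} (hβ : 0 < β) (hω : ∀ j, 0 < ω j)
    (u v : ι → ℂ) (d : ℂ) :
    ∑' n, ENNReal.ofReal (gibbsWeight β ω n) * sqSum (linOp u v d (ket n)) =
      thermalMoment β ω u v + ‖d‖ₑ ^ 2 := by
  have h0 := tsum_gibbsWeight hβ hω
  have h1 : ∀ n : ι → ℕ, ENNReal.ofReal (gibbsWeight β ω n) * sqSum (linOp u v d (ket n)) =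
      ∑ r, (‖u r‖ₑ ^ 2 * (n r * ENNReal.ofReal (gibbsWeight β ω n)) + ‖v r‖ₑ ^ 2 *
        (n r * ENNReal.ofReal (gibbsWeight β ω n) + ENNReal.ofReal (gibbsWeight β ω n))) +
        ‖d‖ₑ ^ 2 * ENNReal.ofReal (gibbsWeight β ω n) := by
    intro n
    rw [sqSum_linOp_ket, mul_add, Finset.mul_sum, mul_comm _ (‖d‖ₑ ^ 2)]
    congr 1
    exact Finset.sum_congr rfl fun r _ => by ring
  simp only [h1]
  rw [ENNReal.tsum_add, Summable.tsum_finsetSum fun _ _ => ENNReal.summable, ENNReal.tsum_mul_left,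
    h0, mul_one]
  congr 1
  refine Finset.sum_congr rfl fun r _ => ?_
  rw [ENNReal.tsum_add, ENNReal.tsum_mul_left, ENNReal.tsum_mul_left, ENNReal.tsum_add,
    tsum_mul_gibbsWeight hβ hω, h0]

end Ket

/-! ### Mode operators on tensor products -/

section Tensor

variable {ι κ : Type}

theorem sqSum_sum (f : (ι ⊕ κ → ℕ) → ℂ) :
    sqSum f = ∑' b : κ → ℕ, sqSum fun a : ι → ℕ => f (Sum.elim a b) := by
  simp only [sqSum]
  rw [← ENNReal.tsum_prod, ← ((Equiv.sumArrowEquivProdArrow ι κ ℕ).trans (Equiv.prodComm _ _)).symm.tsum_eq]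
  rfl

/-- The coordinates of `(1 ⊗ ⟨k|) f`. -/
def slice (k : κ → ℕ) (f : (ι ⊕ κ → ℕ) → ℂ) : (ι → ℕ) → ℂ := fun a => f (Sum.elim a k)

theorem tsum_sqSum_slice (f : (ι ⊕ κ → ℕ) → ℂ) :
    ∑' k : κ → ℕ, sqSum (slice (ι := ι) k f) = sqSum f := (sqSum_sum f).symm

section

variable [DecidableEq ι] [DecidableEq κ]

theorem elim_add_single_inl (a : ι → ℕ) (b : κ → ℕ) (i : ι) :
    (Sum.elim a b + Pi.single (Sum.inl i) 1 : ι ⊕ κ → ℕ) = Sum.elim (a + Pi.single i 1) b := by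
  funext x
  rcases x with x | x <;> simp [Pi.single_apply]

theorem elim_add_single_inr (a : ι → ℕ) (b : κ → ℕ) (r : κ) :
    (Sum.elim a b + Pi.single (Sum.inr r) 1 : ι ⊕ κ → ℕ) = Sum.elim a (b + Pi.single r 1) := by
  funext x
  rcases x with x | x <;> simp [Pi.single_apply]

theorem elim_sub_single_inl (a : ι → ℕ) (b : κ → ℕ) (i : ι) :
    (Sum.elim a b - Pi.single (Sum.inl i) 1 : ι ⊕ κ → ℕ) = Sum.elim (a - Pi.single i 1) b := by
  funext x
  rcases x with x | x <;> simp [Pi.single_apply]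

theorem elim_sub_single_inr (a : ι → ℕ) (b : κ → ℕ) (r : κ) :
    (Sum.elim a b - Pi.single (Sum.inr r) 1 : ι ⊕ κ → ℕ) = Sum.elim a (b - Pi.single r 1) := by
  funext x
  rcases x with x | x <;> simp [Pi.single_apply]

end

variable [Fintype κ]

theorem tensorKetFun_apply (k : κ → ℕ) (ψ : (ι → ℕ) → ℂ) (a : ι → ℕ) (b : κ → ℕ) :
    tensorKetFun k ψ (Sum.elim a b) = ket k b * ψ a := by
  simp only [tensorKetFun, ket_apply, Sum.elim_inl, Sum.elim_inr, ite_mul, one_mul, zero_mul]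
  rfl

variable [Fintype ι] [DecidableEq ι] [DecidableEq κ]

/-- `A (ψ ⊗ |k⟩) = A₁ ψ ⊗ |k⟩ + ψ ⊗ A₂ |k⟩`, where `A₁` and `A₂` are the parts of `A` that act
on the two factors. -/
theorem linOp_tensorKetFun (u v : ι ⊕ κ → ℂ) (d : ℂ) (k : κ → ℕ) (ψ : (ι → ℕ) → ℂ) (a : ι → ℕ)
    (b : κ → ℕ) :
    linOp u v d (tensorKetFun k ψ) (Sum.elim a b) =
      ket k b * linOp (u ∘ Sum.inl) (v ∘ Sum.inl) d ψ a +
        linOp (u ∘ Sum.inr) (v ∘ Sum.inr) 0 (ket k) b * ψ a := by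
  simp only [linOp, annih, creat, Fintype.sum_sum_type, elim_add_single_inl, elim_add_single_inr,
    elim_sub_single_inl, elim_sub_single_inr, tensorKetFun_apply, Sum.elim_inl, Sum.elim_inr,
    Function.comp_apply, mul_add, add_mul, Finset.mul_sum, Finset.sum_mul, Finset.sum_add_distrib,
    zero_mul]
  simp only [mul_comm, mul_left_comm]
  ring

/-- The constant `d` is assigned to the first factor. The second part then has `⟨k| A₂ |k⟩ = 0`, so
the two contributions are orthogonal and no cross term appears. -/
theorem sqSum_linOp_tensorKetFun (u v : ι ⊕ κ → ℂ) (d : ℂ) (k : κ → ℕ) (ψ : (ι → ℕ) → ℂ) :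
    sqSum (linOp u v d (tensorKetFun k ψ)) =
      sqSum (linOp (u ∘ Sum.inl) (v ∘ Sum.inl) d ψ) +
        sqSum (linOp (u ∘ Sum.inr) (v ∘ Sum.inr) 0 (ket k)) * sqSum ψ := by
  have hk : linOp (u ∘ Sum.inr) (v ∘ Sum.inr) 0 (ket k) k = 0 := by
    have h1 : ∀ r : κ, ¬ (k + Pi.single r 1 = k) := fun r h => by simpa using congrFun h r
    simp [linOp, annih_ket_apply, creat_ket_apply, h1]
  have hb : ∀ b : κ → ℕ, sqSum (fun a : ι → ℕ => linOp u v d (tensorKetFun k ψ) (Sum.elim a b)) =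
      sqSum (linOp (u ∘ Sum.inl) (v ∘ Sum.inl) d ψ) * ‖ket k b‖ₑ ^ 2 +
        ‖linOp (u ∘ Sum.inr) (v ∘ Sum.inr) 0 (ket k) b‖ₑ ^ 2 * sqSum ψ := by
    intro b
    simp only [linOp_tensorKetFun]
    by_cases h : b = k
    · subst h
      simp [hk, ket_apply]
    · simp only [ket_apply, if_neg h, zero_mul, zero_add, sqSum_smul]
      simp
  rw [sqSum_sum]
  simp only [hb]
  rw [ENNReal.tsum_add, ENNReal.tsum_mul_right,
    tsum_mul_enorm_ket (fun _ => sqSum (linOp (u ∘ Sum.inl) (v ∘ Sum.inl) d ψ)) k]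
  rfl

theorem linOp_slice (u v : ι → ℂ) (d : ℂ) (k : κ → ℕ) (f : (ι ⊕ κ → ℕ) → ℂ) :
    linOp u v d (slice k f) =
      slice k (linOp (Sum.elim u fun _ => 0) (Sum.elim v fun _ => 0) d f) := by
  funext a
  simp [linOp, slice, annih, creat, elim_add_single_inl, elim_sub_single_inl]

end Tensor

end HBAC

namespace HBAC

/-! ### Decompositions of states into vectors with finite mean excitation number -/

section Sandwich

variable {E F : Type*} [NormedAddCommGroup E] [InnerProductSpace ℂ E]

theorem rankOne_smul_smul (c : ℝ) (hc : 0 ≤ c) (x : E) :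
    InnerProductSpace.rankOne ℂ ((Real.sqrt c : ℂ) • x) ((Real.sqrt c : ℂ) • x) =
      (c : ℂ) • InnerProductSpace.rankOne ℂ x x := by
  have h : (Real.sqrt c : ℂ) * Real.sqrt c = c := by
    rw [← Complex.ofReal_mul, Real.mul_self_sqrt hc]
  ext y
  simp only [InnerProductSpace.rankOne_apply, inner_smul_left, Complex.conj_ofReal,
    smul_apply, smul_smul, ← h]
  ring_nf

variable [CompleteSpace E] [NormedAddCommGroup F] [InnerProductSpace ℂ F] [CompleteSpace F]

theorem sandwich_rankOne (A : E →L[ℂ] F) (x : E) :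
    A ∘L InnerProductSpace.rankOne ℂ x x ∘L ContinuousLinearMap.adjoint A =
      InnerProductSpace.rankOne ℂ (A x) (A x) := by
  ext y
  simp [ContinuousLinearMap.adjoint_inner_right]

theorem hasSum_sandwich {I : Type*} {ψ : I → E} {ρ : E →L[ℂ] E}
    (h : HasSum (fun i => InnerProductSpace.rankOne ℂ (ψ i) (ψ i)) ρ) {A : E →L[ℂ] F}
    {B : F →L[ℂ] E} (hB : ContinuousLinearMap.adjoint A = B) :
    HasSum (fun i => InnerProductSpace.rankOne ℂ (A (ψ i)) (A (ψ i))) (A ∘L ρ ∘L B) := by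
  subst hB
  have := (h.mapL ((ContinuousLinearMap.compL ℂ F E E).flip (ContinuousLinearMap.adjoint A))).mapL
    (ContinuousLinearMap.compL ℂ F E F A)
  simpa [sandwich_rankOne] using this

end Sandwich

variable {ι κ I : Type}

/-- The norm of `|ψ⟩⟨ψ|` is `‖ψ‖²`, so finite total weight gives absolute convergence. -/
theorem summable_rankOne {ψ : I → Fock ι} (h : ∑' i, sqSum (ψ i) ≠ ⊤) :
    Summable fun i => InnerProductSpace.rankOne ℂ (ψ i) (ψ i) := by
  refine Summable.of_norm ?_
  have h1 : ∑' i, ((‖ψ i‖₊ ^ 2 : NNReal) : ℝ≥0∞) ≠ ⊤ := by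
    simpa [sqSum_coe, enorm_eq_nnnorm] using h
  have h2 := NNReal.summable_coe.2 (ENNReal.tsum_coe_ne_top_iff_summable.1 h1)
  simpa [pow_two] using h2

theorem sqSum_smul_fock (c : ℝ) (hc : 0 ≤ c) (ψ : Fock ι) :
    sqSum ((Real.sqrt c : ℂ) • ψ : Fock ι) = ENNReal.ofReal c * sqSum ψ := by
  rw [← enorm_sqrt_sq hc, ← sqSum_smul]
  rfl

section

variable [Fintype κ]

theorem sqSum_tensorKet (k : κ → ℕ) (ψ : Fock ι) :
    sqSum (tensorKet k ψ : Fock (ι ⊕ κ)) = sqSum ψ := by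
  rw [sqSum_coe, sqSum_coe, ← ofReal_norm, LinearIsometry.norm_map, ofReal_norm]

variable [Fintype ι]

theorem tensorKet_ket (k : κ → ℕ) (a : ι → ℕ) :
    (tensorKet k (ket a) : Fock (ι ⊕ κ)) = ket (Sum.elim a k) := by
  ext f
  change tensorKetFun k (ket a) f = _
  obtain ⟨a', b, rfl⟩ : ∃ (a' : ι → ℕ) (b : κ → ℕ), f = Sum.elim a' b :=
    ⟨_, _, (Sum.elim_comp_inl_inr f).symm⟩
  rw [tensorKetFun_apply, ket_apply, ket_apply, ket_apply]
  by_cases h1 : b = k <;> by_cases h2 : a' = a <;> simp [h1, h2, Sum.elim_eq_iff]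

/-- The decomposition of the partial trace of a state. -/
def ptraceVec (ψ : I → Fock (ι ⊕ κ)) (x : (κ → ℕ) × I) : Fock ι :=
  ContinuousLinearMap.adjoint (tensorKet x.1 : Fock ι →ₗᵢ[ℂ] Fock (ι ⊕ κ)).toContinuousLinearMap
    (ψ x.2)

theorem coe_ptraceVec (ψ : I → Fock (ι ⊕ κ)) (x : (κ → ℕ) × I) :
    (ptraceVec ψ x : (ι → ℕ) → ℂ) = slice x.1 (ψ x.2) := by
  funext a
  rw [← inner_ket_left, ptraceVec, ContinuousLinearMap.adjoint_inner_right]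
  change ⟪tensorKet x.1 (ket a), ψ x.2⟫_ℂ = _
  rw [tensorKet_ket, inner_ket_left]
  rfl

/-- The partial trace preserves the trace: the slices of a vector partition its coordinates. -/
theorem tsum_sqSum_ptraceVec (ψ : I → Fock (ι ⊕ κ)) :
    ∑' x, sqSum (ptraceVec ψ x) = ∑' i, sqSum (ψ i) := by
  have h : ∀ x, sqSum (ptraceVec ψ x) = sqSum (slice (ι := ι) x.1 (ψ x.2)) := fun x => by
    rw [coe_ptraceVec]
  simp only [h]
  rw [ENNReal.tsum_prod' (f := fun x : (κ → ℕ) × I => sqSum (slice (ι := ι) x.1 (ψ x.2))),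
    ENNReal.tsum_comm]
  exact tsum_congr fun i => tsum_sqSum_slice (ψ i)

end

variable [Fintype ι] [DecidableEq ι]

theorem linOp_smul (u v : ι → ℂ) (d c : ℂ) (ψ : Fock ι) :
    linOp u v d (c • ψ : Fock ι) = fun n => c * linOp u v d ψ n := by
  funext n
  have h : ∀ m, (c • ψ : Fock ι) m = c * ψ m := fun m => rfl
  simp only [linOp, annih, creat, h, mul_add, Finset.mul_sum]
  congr 1
  · exact Finset.sum_congr rfl fun k _ => by ring
  · ring

theorem sqSum_linOp_smul (u v : ι → ℂ) (d : ℂ) (c : ℝ) (hc : 0 ≤ c) (ψ : Fock ι) :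
    sqSum (linOp u v d ((Real.sqrt c : ℂ) • ψ : Fock ι)) =
      ENNReal.ofReal c * sqSum (linOp u v d ψ) := by
  rw [linOp_smul, sqSum_smul, enorm_sqrt_sq hc]

theorem annih_eq_linOp (j : ι) (f : (ι → ℕ) → ℂ) : annih j f = linOp (Pi.single j 1) 0 0 f := by
  funext n
  simp [linOp, Pi.single_apply]

/-- In this form the domain condition passes directly through scaling, tensor products and slices,
using the norm identities for `linOp`. -/
theorem finiteNumber_iff_linOp (ψ : Fock ι) :
    FiniteNumber ψ ↔ ∀ u v d, sqSum (linOp u v d ψ) ≠ ⊤ := by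
  constructor
  · exact fun h u v d => (memℓp_two_iff _).1 (h.memℓp_linOp u v d)
  · intro h
    refine (finiteNumber_iff ψ).2 fun j => ?_
    rw [annih_eq_linOp]
    exact h _ _ _

/-- The state `ρ` is `∑ i, |ψ i⟩⟨ψ i|`. -/
structure IsEnsemble (ψ : I → Fock ι) (ρ : Op ι) : Prop where
  finiteNumber : ∀ i, FiniteNumber (ψ i)
  tsum_sqSum : ∑' i, sqSum (ψ i) = 1
  hasSum : HasSum (fun i => InnerProductSpace.rankOne ℂ (ψ i) (ψ i)) ρ

/-- The expectation value of `A† A` for `A = ∑ k, (u k a_k + v k a_k†) + d`. -/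
def moment (ψ : I → Fock ι) (u v : ι → ℂ) (d : ℂ) : ℝ≥0∞ := ∑' i, sqSum (linOp u v d (ψ i))

section Gibbs

variable {β : ℝ} {ω : ι → ℝ}

/-- The decomposition of the Gibbs state into occupation number states. -/
def gibbsVec (β : ℝ) (ω : ι → ℝ) (n : ι → ℕ) : Fock ι :=
  (Real.sqrt (gibbsWeight β ω n) : ℂ) • ket n

theorem isEnsemble_gibbs (hβ : 0 < β) (hω : ∀ j, 0 < ω j) :
    IsEnsemble (gibbsVec β ω) (gibbs β ω) := by
  have h1 : ∑' n, sqSum (gibbsVec β ω n) = 1 := by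
    simp only [gibbsVec, sqSum_smul_fock _ (gibbsWeight_nonneg _), sqSum_ket, mul_one]
    exact tsum_gibbsWeight hβ hω
  refine ⟨fun n => ?_, h1, ?_⟩
  · rw [finiteNumber_iff_linOp]
    intro u v d
    rw [gibbsVec, sqSum_linOp_smul _ _ _ _ (gibbsWeight_nonneg _)]
    exact ENNReal.mul_ne_top ENNReal.ofReal_ne_top
      ((finiteNumber_iff_linOp _).1 (finiteNumber_ket n) u v d)
  · have := (summable_rankOne (h1 ▸ ENNReal.one_ne_top)).hasSum
    convert this using 1
    exact tsum_congr fun n => (rankOne_smul_smul _ (gibbsWeight_nonneg n) _).symm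

theorem moment_gibbs (hβ : 0 < β) (hω : ∀ j, 0 < ω j) (u v : ι → ℂ) (d : ℂ) :
    moment (gibbsVec β ω) u v d = thermalMoment β ω u v + ‖d‖ₑ ^ 2 := by
  simp only [moment, gibbsVec, sqSum_linOp_smul _ _ _ _ (gibbsWeight_nonneg _)]
  exact tsum_gibbsWeight_mul_sqSum hβ hω u v d

end Gibbs

section Conj

variable {ψ : I → Fock ι} {ρ : Op ι} {W : Uni ι} {C S : Matrix ι ι ℂ} {d : ι → ℂ}

theorem IsEnsemble.conj (h : IsEnsemble ψ ρ) (H : Implements W C S d) :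
    IsEnsemble (fun i => W (ψ i)) (conj W ρ) := by
  refine ⟨fun i => (H _ (h.finiteNumber i)).1, ?_, ?_⟩
  · rw [← h.tsum_sqSum]
    refine tsum_congr fun i => ?_
    rw [sqSum_coe, sqSum_coe, ← ofReal_norm, W.norm_map, ofReal_norm]
  · exact hasSum_sandwich (A := (W.toContinuousLinearEquiv : Op ι)) h.hasSum
      (LinearIsometryEquiv.adjoint_eq_symm W)

theorem moment_conj (h : IsEnsemble ψ ρ) (H : Implements W C S d) (u v : ι → ℂ) (e : ℂ) :
    moment (fun i => W (ψ i)) u v e = moment ψ (fun k => ∑ j, (u j * C j k + v j * star (S j k)))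
      (fun k => ∑ j, (u j * S j k + v j * star (C j k)))
      (e + ∑ j, (u j * d j + v j * star (d j))) :=
  tsum_congr fun i => H.sqSum_linOp (h.finiteNumber i) u v e

end Conj

variable [Fintype κ] [DecidableEq κ]

section TensorGibbs

variable {ψ : I → Fock ι} {ρ : Op ι} {β : ℝ} {ν : κ → ℝ}

/-- The decomposition of the tensor product of a state with a Gibbs state. -/
def tensorGibbsVec (β : ℝ) (ν : κ → ℝ) (ψ : I → Fock ι) (x : (κ → ℕ) × I) : Fock (ι ⊕ κ) :=
  (Real.sqrt (gibbsWeight β ν x.1) : ℂ) • tensorKet x.1 (ψ x.2)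

theorem isEnsemble_tensorGibbs (hβ : 0 < β) (hν : ∀ j, 0 < ν j) (h : IsEnsemble ψ ρ) :
    IsEnsemble (tensorGibbsVec β ν ψ) (tensorGibbs β ν ρ) := by
  have h1 : ∑' x, sqSum (tensorGibbsVec β ν ψ x) = 1 := by
    simp only [tensorGibbsVec, sqSum_smul_fock _ (gibbsWeight_nonneg _), sqSum_tensorKet]
    rw [ENNReal.tsum_prod']
    simp only [ENNReal.tsum_mul_left, h.tsum_sqSum, mul_one]
    exact tsum_gibbsWeight hβ hν
  refine ⟨fun x => ?_, h1, ?_⟩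
  · rw [finiteNumber_iff_linOp]
    intro u v d
    rw [tensorGibbsVec, sqSum_linOp_smul _ _ _ _ (gibbsWeight_nonneg _)]
    refine ENNReal.mul_ne_top ENNReal.ofReal_ne_top ?_
    change sqSum (linOp u v d (tensorKetFun x.1 (ψ x.2))) ≠ ⊤
    rw [sqSum_linOp_tensorKetFun]
    exact ENNReal.add_ne_top.2 ⟨(finiteNumber_iff_linOp _).1 (h.finiteNumber _) _ _ _,
      ENNReal.mul_ne_top ((finiteNumber_iff_linOp _).1 (finiteNumber_ket _) _ _ _)
        ((memℓp_two_iff _).1 (lp.memℓp _))⟩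
  · have hs := (summable_rankOne (h1 ▸ ENNReal.one_ne_top)).hasSum
    -- The double family converges absolutely. Summing it first over the ensemble gives the terms in
    -- the definition of `tensorGibbs`, so that `tsum` is a genuine sum.
    have hf := hs.prod_fiberwise (g := fun k => (gibbsWeight β ν k : ℂ) •
      ((tensorKet k).toContinuousLinearMap ∘L ρ ∘L ContinuousLinearMap.adjoint
        (tensorKet k : Fock ι →ₗᵢ[ℂ] Fock (ι ⊕ κ)).toContinuousLinearMap)) fun k => by
      simp only [tensorGibbsVec, rankOne_smul_smul _ (gibbsWeight_nonneg _)]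
      exact (hasSum_sandwich
        (A := (tensorKet k : Fock ι →ₗᵢ[ℂ] Fock (ι ⊕ κ)).toContinuousLinearMap)
        h.hasSum rfl).const_smul _
    rw [tensorGibbs, hf.tsum_eq]
    exact hs

theorem moment_tensorGibbs (hβ : 0 < β) (hν : ∀ j, 0 < ν j) (h : IsEnsemble ψ ρ)
    (u v : ι ⊕ κ → ℂ) (d : ℂ) :
    moment (tensorGibbsVec β ν ψ) u v d =
      moment ψ (u ∘ Sum.inl) (v ∘ Sum.inl) d + thermalMoment β ν (u ∘ Sum.inr) (v ∘ Sum.inr) := by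
  have h1 : ∀ x, sqSum (linOp u v d (tensorGibbsVec β ν ψ x)) =
      ENNReal.ofReal (gibbsWeight β ν x.1) * sqSum (linOp (u ∘ Sum.inl) (v ∘ Sum.inl) d (ψ x.2)) +
      ENNReal.ofReal (gibbsWeight β ν x.1) *
        sqSum (linOp (u ∘ Sum.inr) (v ∘ Sum.inr) 0 (ket x.1)) * sqSum (ψ x.2) := by
    intro x
    rw [tensorGibbsVec, sqSum_linOp_smul _ _ _ _ (gibbsWeight_nonneg _), mul_assoc, ← mul_add,
      ← sqSum_linOp_tensorKetFun]
    rfl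
  have h2 := tsum_gibbsWeight_mul_sqSum hβ hν (u ∘ Sum.inr) (v ∘ Sum.inr) 0
  simp only [moment, h1]
  rw [ENNReal.tsum_add, ENNReal.tsum_prod', ENNReal.tsum_prod']
  simp only [ENNReal.tsum_mul_left, ENNReal.tsum_mul_right, h.tsum_sqSum, h2,
    tsum_gibbsWeight hβ hν]
  simp

end TensorGibbs

section Ptrace

variable {ψ : I → Fock (ι ⊕ κ)} {ρ : Op (ι ⊕ κ)}

/-- An operator on the modes `ι` commutes with `⟨k|` on the modes `κ`, and the squared norms of the
slices add up. -/
theorem moment_ptrace (ψ : I → Fock (ι ⊕ κ)) (u v : ι → ℂ) (d : ℂ) :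
    moment (ptraceVec ψ) u v d = moment ψ (Sum.elim u fun _ => 0) (Sum.elim v fun _ => 0) d := by
  simp only [moment, coe_ptraceVec, linOp_slice]
  rw [ENNReal.tsum_prod', ENNReal.tsum_comm]
  exact tsum_congr fun i => tsum_sqSum_slice
    (linOp (Sum.elim u fun _ => 0) (Sum.elim v fun _ => 0) d (ψ i))

theorem isEnsemble_ptrace (h : IsEnsemble ψ ρ) : IsEnsemble (ptraceVec ψ) (ptrace ρ) := by
  have h1 := (tsum_sqSum_ptraceVec ψ).trans h.tsum_sqSum
  refine ⟨fun x => ?_, h1, ?_⟩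
  · rw [finiteNumber_iff_linOp]
    intro u v d
    rw [coe_ptraceVec, linOp_slice]
    refine ne_top_of_le_ne_top ((finiteNumber_iff_linOp (ψ x.2)).1 (h.finiteNumber x.2)
      (Sum.elim u fun _ => 0) (Sum.elim v fun _ => 0) d) ?_
    rw [← tsum_sqSum_slice (linOp (Sum.elim u fun _ => 0) (Sum.elim v fun _ => 0) d (ψ x.2))]
    exact ENNReal.le_tsum (f := fun k => sqSum (slice (ι := ι) k
      (linOp (Sum.elim u fun _ => 0) (Sum.elim v fun _ => 0) d (ψ x.2)))) x.1
  · have hs := (summable_rankOne (h1 ▸ ENNReal.one_ne_top)).hasSum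
    have hk : ∀ k : κ → ℕ, HasSum (fun i : I => InnerProductSpace.rankOne ℂ (ptraceVec ψ (k, i))
        (ptraceVec ψ (k, i))) (ContinuousLinearMap.adjoint
          (tensorKet k : Fock ι →ₗᵢ[ℂ] Fock (ι ⊕ κ)).toContinuousLinearMap ∘L
          ρ ∘L (tensorKet k).toContinuousLinearMap) := fun k =>
      hasSum_sandwich (A := ContinuousLinearMap.adjoint
        (tensorKet k : Fock ι →ₗᵢ[ℂ] Fock (ι ⊕ κ)).toContinuousLinearMap) h.hasSum
        (ContinuousLinearMap.adjoint_adjoint _)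
    rw [ptrace, (hs.prod_fiberwise hk).tsum_eq]
    exact hs

end Ptrace

end HBAC

namespace HBAC

/-! ### Lower bounds on the excitation of a state -/

section Bound

variable {ι κ I : Type}

theorem single_one_injective [DecidableEq ι] : Function.Injective fun r : ι => (Pi.single r 1 : ι → ℕ) := by
  intro r s h
  by_contra hrs
  have := congrFun h r
  simp [hrs] at this

variable [Fintype ι] [Fintype κ]

/-- The occupation bound is required only on the modes where `u` is nonzero. This allows reservoir
modes with occupation below `c`. -/
theorem ofReal_le_thermalMoment {β c : ℝ} {ω : ι → ℝ} (hc : 0 ≤ c) (u v : ι → ℂ)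
    (h : ∀ k, u k ≠ 0 → c ≤ occ β (ω k)) :
    ENNReal.ofReal (c * ∑ k, ‖u k‖ ^ 2) ≤ thermalMoment β ω u v := by
  rw [Finset.mul_sum, ENNReal.ofReal_sum_of_nonneg fun k _ => by positivity]
  refine Finset.sum_le_sum fun k _ => le_trans ?_ le_self_add
  by_cases hk : u k = 0
  · simp [hk]
  · rw [mul_comm c, ENNReal.ofReal_mul (by positivity), ← enorm_sq_eq_ofReal]
    gcongr
    exact h k hk

theorem sum_norm_sq_elim (u : ι → ℂ) :
    ∑ k, ‖(Sum.elim u fun _ => 0 : ι ⊕ κ → ℂ) k‖ ^ 2 = ∑ k, ‖u k‖ ^ 2 := by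
  simp [Fintype.sum_sum_type]

variable [DecidableEq ι] [DecidableEq κ]

/-- The covariance matrix of the state dominates the one of the pure states, scaled by the factor
`2 * c + 1`: `tr (A† A ρ) ≥ c [A, A†]` for all affine combinations `A` of the mode operators. -/
def NumberBound (c : ℝ) (ψ : I → Fock ι) : Prop :=
  ∀ (u v : ι → ℂ) (d : ℂ), ENNReal.ofReal (c * (∑ k, ‖u k‖ ^ 2 - ∑ k, ‖v k‖ ^ 2)) ≤ moment ψ u v d

theorem numberBound_gibbs {β c : ℝ} {ω : ι → ℝ} (hβ : 0 < β) (hω : ∀ j, 0 < ω j) (hc : 0 ≤ c)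
    (h : ∀ j, c ≤ occ β (ω j)) : NumberBound c (gibbsVec β ω) := by
  intro u v d
  rw [moment_gibbs hβ hω]
  refine (ENNReal.ofReal_le_ofReal ?_).trans
    ((ofReal_le_thermalMoment hc u v fun k _ => h k).trans le_self_add)
  have : 0 ≤ ∑ k, ‖v k‖ ^ 2 := Finset.sum_nonneg fun k _ => by positivity
  exact mul_le_mul_of_nonneg_left (by linarith) hc

theorem NumberBound.conj {c : ℝ} {ψ : I → Fock ι} {ρ : Op ι} {W : Uni ι}
    (hb : NumberBound c ψ) (h : IsEnsemble ψ ρ) (hW : IsGaussian W) :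
    NumberBound c fun i => W (ψ i) := by
  obtain ⟨C, S, d, h1, h2, H⟩ := (isGaussian_iff W).1 hW
  intro u v e
  rw [moment_conj h H, ← commutator_bogoliubov h1 h2]
  exact hb _ _ _

theorem NumberBound.ptrace {c : ℝ} {ψ : I → Fock (ι ⊕ κ)} (hb : NumberBound c ψ) :
    NumberBound c (ptraceVec ψ) := by
  intro u v d
  rw [moment_ptrace]
  simpa only [sum_norm_sq_elim] using hb (Sum.elim u fun _ => 0) (Sum.elim v fun _ => 0) d

/-- `U` maps each eigenspace of the Hamiltonian into itself and `a_j` lowers the energy by `ω j`.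
Hence `⟨m| U† a_j U |n⟩` vanishes unless the energies of `m` and `n` differ by exactly `ω j`. -/
theorem EnergyPreserving.linOp_ket_eq_zero {ω : ι → ℝ} {U : Uni ι} {C S : Matrix ι ι ℂ} {d : ι → ℂ}
    (hU : EnergyPreserving ω U) (H : Implements U C S d) (j : ι) (n m : ι → ℕ)
    (h : energy ω m + ω j ≠ energy ω n) : linOp (C j) (S j) (d j) (ket n) m = 0 := by
  have supp : ∀ n l : ι → ℕ, U (ket n) l ≠ 0 → energy ω l = energy ω n := by
    intro n l hl
    have hφ := hU (ket n) ((energy ω n : ℂ) • ket n) (fun k => by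
      change (energy ω n : ℂ) * ket n k = energy ω k * ket n k
      rw [ket_apply]
      split_ifs with hk
      · rw [hk]
      · simp) l
    rw [map_smul] at hφ
    exact (Complex.ofReal_injective (mul_right_cancel₀ hl hφ)).symm
  have hx := (H (ket n) (finiteNumber_ket n)).2 j
  rw [← linVec_apply _ _ _ _ (finiteNumber_ket n), ← inner_ket_left, ← U.inner_map_map,
    lp.inner_eq_tsum]
  refine (tsum_congr fun l => ?_).trans tsum_zero
  rw [← hx]
  by_cases h1 : U (ket m) l = 0
  · simp [h1]
  · by_cases h2 : U (ket n) (l + Pi.single j 1) = 0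
    · simp [annih, h2]
    · have e1 := supp m l h1
      have e2 := supp n _ h2
      have e3 : energy ω (Pi.single j 1 : ι → ℕ) = ω j := by
        simp [energy, Pi.single_apply]
      rw [energy_add, e3, e1] at e2
      exact absurd e2 h

/-- An energy-preserving Gaussian unitary mixes only modes of equal frequency. -/
theorem energyPreserving_coeff {ω : ι → ℝ} (hω : ∀ j, 0 < ω j) {U : Uni ι} {C S : Matrix ι ι ℂ}
    {d : ι → ℂ} (hU : EnergyPreserving ω U) (H : Implements U C S d) (j r : ι) :
    (ω j ≠ ω r → C j r = 0) ∧ S j r = 0 := by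
  have e0 : energy ω (0 : ι → ℕ) = 0 := by simp [energy]
  have e1 : energy ω (Pi.single r 1 : ι → ℕ) = ω r := by simp [energy, Pi.single_apply]
  have n0 : ∀ k : ι, (0 : ι → ℕ) ≠ Pi.single k 1 := fun k h => by
    simpa using congrFun h k
  have hs : ∀ k : ι, (Pi.single k 1 : ι → ℕ) = Pi.single r 1 ↔ k = r := fun k =>
    single_one_injective.eq_iff
  have hs' : ∀ k : ι, (Pi.single r 1 : ι → ℕ) = Pi.single k 1 ↔ r = k := fun k =>
    single_one_injective.eq_iff
  constructor
  · intro hne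
    -- The matrix element from one excitation in mode `r` to the vacuum is exactly `C j r`.
    have := hU.linOp_ket_eq_zero H j (Pi.single r 1) 0 (by rw [e0, e1]; simpa)
    have n1 : ∀ k : ι, (0 : ι → ℕ) ≠ Pi.single r 1 + Pi.single k 1 := fun k h => by
      simpa using congrFun h k
    simpa [linOp, annih_ket_apply, creat_ket_apply, ket_apply, n0, n1, hs] using this
  -- The matrix element from the vacuum to one excitation is `S j r`. It would need `ω r + ω j = 0`,
  -- which positivity excludes.
  · have := hU.linOp_ket_eq_zero H j 0 (Pi.single r 1) (by
      rw [e0, e1]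
      exact (add_pos (hω r) (hω j)).ne')
    have n1 : ∀ k : ι, (Pi.single r 1 + Pi.single k 1 : ι → ℕ) ≠ 0 := fun k h => by
      simpa using congrFun h k
    simpa [linOp, annih_ket_apply, creat_ket_apply, ket_apply, (n0 _).symm, n1, hs'] using this

/-- The transformed operator splits into a part on the system, covered by `hb`, and a part on the
reservoir, covered by its thermal occupation. The latter suffices because reservoir modes with
occupation below `c` are decoupled from the system. -/
theorem NumberBound.thermalize {c β : ℝ} {ω : ι → ℝ} {ν : κ → ℝ} {ψ : I → Fock ι} {ρ : Op ι}
    {U : Uni (ι ⊕ κ)} (hb : NumberBound c ψ) (hc : 0 ≤ c) (hβ : 0 < β) (hω : ∀ j, 0 < ω j)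
    (hν : ∀ k, 0 < ν k) (hcω : ∀ j, c ≤ occ β (ω j)) (h : IsEnsemble ψ ρ) (hU : IsGaussian U)
    (hE : EnergyPreserving (Sum.elim ω ν) U) :
    NumberBound c (ptraceVec fun x => U (tensorGibbsVec β ν ψ x)) := by
  obtain ⟨C, S, d, h1, h2, H⟩ := (isGaussian_iff U).1 hU
  have hpos : ∀ j, 0 < Sum.elim ω ν j := by rintro (j | k) <;> simp [hω, hν]
  intro u v e
  rw [moment_ptrace, moment_conj (isEnsemble_tensorGibbs hβ hν h) H,
    moment_tensorGibbs hβ hν h, ← sum_norm_sq_elim (κ := κ) u, ← sum_norm_sq_elim (κ := κ) v,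
    ← commutator_bogoliubov h1 h2]
  set u' := fun k => ∑ j, ((Sum.elim u fun _ => 0 : ι ⊕ κ → ℂ) j * C j k +
    (Sum.elim v fun _ => 0 : ι ⊕ κ → ℂ) j * star (S j k)) with hu'
  set v' := fun k => ∑ j, ((Sum.elim u fun _ => 0 : ι ⊕ κ → ℂ) j * S j k +
    (Sum.elim v fun _ => 0 : ι ⊕ κ → ℂ) j * star (C j k))
  -- A reservoir mode with occupation below `c` differs in frequency from every system mode, so no
  -- system operator acquires a component on it.
  have hur : ∀ k, (u' ∘ Sum.inr) k ≠ 0 → c ≤ occ β (ν k) := by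
    intro k hk
    by_contra hlt
    refine hk (Finset.sum_eq_zero fun j _ => ?_)
    rw [(energyPreserving_coeff hpos hE H j (Sum.inr k)).2]
    rcases j with j | j
    · rw [(energyPreserving_coeff hpos hE H (Sum.inl j) (Sum.inr k)).1]
      · simp
      · intro heq
        simp only [Sum.elim_inl, Sum.elim_inr] at heq
        exact hlt (heq ▸ hcω j)
    · simp
  refine le_trans (ENNReal.ofReal_le_ofReal ?_) ((ENNReal.ofReal_add_le).trans
    (add_le_add (hb (u' ∘ Sum.inl) (v' ∘ Sum.inl) _)
      (ofReal_le_thermalMoment hc (u' ∘ Sum.inr) (v' ∘ Sum.inr) hur)))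
  rw [← mul_add]
  refine mul_le_mul_of_nonneg_left ?_ hc
  change ∑ k, ‖u' k‖ ^ 2 - ∑ k, ‖v' k‖ ^ 2 ≤ _
  rw [Fintype.sum_sum_type, Fintype.sum_sum_type]
  -- The reservoir part of `v'` enters the commutator with a negative sign and can be dropped.
  have : 0 ≤ ∑ k, ‖v' (Sum.inr k)‖ ^ 2 := Finset.sum_nonneg fun k _ => by positivity
  simp only [Function.comp_apply]
  linarith

end Bound

/-! ### Thermal excitation -/

section Excitation

variable {I : Type} {ψ : I → Fock Unit} {ρ : Op Unit}

theorem implements_refl {ι : Type} [Fintype ι] [DecidableEq ι] :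
    Implements (LinearIsometryEquiv.refl ℂ (Fock ι)) 1 0 0 := by
  intro ψ h
  refine ⟨h, fun j => ?_⟩
  funext n
  simp [linOp, Matrix.one_apply]

theorem isGaussian_refl {ι : Type} [Fintype ι] [DecidableEq ι] :
    IsGaussian (LinearIsometryEquiv.refl ℂ (Fock ι)) :=
  (isGaussian_iff _).2 ⟨1, 0, 0, by simp, by simp, implements_refl⟩

theorem energyPreserving_refl {ι : Type} [Fintype ι] (ω : ι → ℝ) :
    EnergyPreserving ω (LinearIsometryEquiv.refl ℂ (Fock ι)) := fun _ _ h => h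

theorem conj_refl {ι : Type} (T : Op ι) :
    HBAC.conj (LinearIsometryEquiv.refl ℂ (Fock ι)) T = T := rfl

theorem meanExcitation_eq (h : IsEnsemble ψ ρ) : meanExcitation ρ = moment ψ 1 0 0 := by
  have h1 : ∀ i, sqSum (linOp 1 0 0 (ψ i)) =
      ∑' n : Unit → ℕ, (n () : ℝ≥0∞) * ‖ψ i n‖ₑ ^ 2 := by
    intro i
    rw [← sqSum_annih, annih_eq_linOp]
    congr 2
  simp only [meanExcitation, moment, h1]
  rw [ENNReal.tsum_comm]
  refine tsum_congr fun n => ?_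
  rw [ENNReal.tsum_mul_left]
  congr 1
  have e1 : HasSum (fun i => ((‖ψ i n‖ ^ 2 : ℝ) : ℂ)) (ρ (ket n) n) := by
    have h2 := h.hasSum.mapL (ContinuousLinearMap.apply ℂ (Fock Unit) (ket n))
    have h3 := h2.mapL (innerSL ℂ (ket n))
    simp only [ContinuousLinearMap.apply_apply, innerSL_apply_apply, inner_ket_left] at h3
    have e : ∀ i, (InnerProductSpace.rankOne ℂ (ψ i) (ψ i) (ket n) : Fock Unit) n =
        ((‖ψ i n‖ ^ 2 : ℝ) : ℂ) := by
      intro i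
      rw [InnerProductSpace.rankOne_apply, ← inner_conj_symm, inner_ket_left]
      change starRingEnd ℂ (ψ i n) * ψ i n = _
      rw [Complex.conj_mul', Complex.ofReal_pow]
    simpa only [e] using h3
  have e2 : HasSum (fun i => ‖ψ i n‖ ^ 2) (ρ (ket n) n).re := by
    simpa only [Complex.ofReal_re] using Complex.hasSum_re e1
  rw [← e2.tsum_eq, ENNReal.ofReal_tsum_of_nonneg (fun i => by positivity) e2.summable]
  exact tsum_congr fun i => (enorm_sq_eq_ofReal _).symm

theorem NumberBound.le_thermalExcitation {c : ℝ} (hb : NumberBound c ψ) (h : IsEnsemble ψ ρ) :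
    ENNReal.ofReal c ≤ thermalExcitation ρ := by
  refine le_iInf fun W => ?_
  obtain ⟨C, S, d, h1, h2, H⟩ := (isGaussian_iff W.1).1 W.2
  rw [meanExcitation_eq (h.conj H)]
  -- For `A = a` the commutator is `1`, so the invariant is the bound by `c` itself.
  simpa using hb.conj h W.2 1 0 0

theorem thermalExcitation_le (h : IsEnsemble ψ ρ) : thermalExcitation ρ ≤ moment ψ 1 0 0 := by
  refine (iInf_le _ ⟨_, isGaussian_refl⟩).trans_eq ?_
  rw [conj_refl, meanExcitation_eq h]

theorem log_one_add_inv_occ {β ω : ℝ} (h : 0 < β * ω) :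
    ENNReal.log (1 + (ENNReal.ofReal (occ β ω))⁻¹) = ((β * ω : ℝ) : EReal) := by
  have h1 := Real.one_lt_exp_iff.2 h
  rw [← ENNReal.ofReal_inv_of_pos (occ_pos h), occ, inv_inv, ← ENNReal.ofReal_one,
    ← ENNReal.ofReal_add zero_le_one (by linarith), add_sub_cancel, ENNReal.log_ofReal,
    if_neg (not_le.2 (Real.exp_pos _)), Real.log_exp]

theorem effInvTemp_le {β ω₀ ω : ℝ} (hω₀ : 0 < ω₀) (h : 0 < β * ω)
    (hρ : ENNReal.ofReal (occ β ω) ≤ thermalExcitation ρ) :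
    effInvTemp ω₀ ρ ≤ ((ω / ω₀ * β : ℝ) : EReal) := by
  have e : ((ω / ω₀ * β : ℝ) : EReal) = ((ω₀⁻¹ : ℝ) : EReal) * ((β * ω : ℝ) : EReal) := by
    rw [← EReal.coe_mul]
    congr 1
    field_simp
  rw [e, effInvTemp, ← log_one_add_inv_occ h]
  refine mul_le_mul_of_nonneg_left (ENNReal.log_monotone ?_)
    (EReal.coe_nonneg.2 (inv_nonneg.2 hω₀.le))
  gcongr

theorem effInvTemp_eq {β ω₀ ω : ℝ} (hω₀ : 0 < ω₀) (h : 0 < β * ω)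
    (hρ : thermalExcitation ρ = ENNReal.ofReal (occ β ω)) :
    effInvTemp ω₀ ρ = ((ω / ω₀ * β : ℝ) : EReal) := by
  rw [effInvTemp, hρ, log_one_add_inv_occ h, ← EReal.coe_mul]
  congr 1
  field_simp

end Excitation

end HBAC

namespace HBAC

/-! ### Second quantization of a unitary matrix

A polynomial in the creation operators, applied to the vacuum, is a vector of the Fock space. A
unitary matrix acts on polynomials by linear substitution, and this action is isometric. -/

open MvPolynomial Matrix

variable {ι : Type} [Fintype ι]

/-- The multi-index with the given coordinates. -/
abbrev multiIndex (n : ι → ℕ) : ι →₀ ℕ := Finsupp.equivFunOnFinite.symm n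

/-- The norm `√(n!)` of the vector `(a†)^n |0⟩`. -/
def sqrtFactorial (n : ι → ℕ) : ℝ := Real.sqrt (∏ j, ((n j).factorial : ℝ))

theorem sqrtFactorial_pos (n : ι → ℕ) : 0 < sqrtFactorial n :=
  Real.sqrt_pos.2 (Finset.prod_pos fun j _ => by exact_mod_cast (n j).factorial_pos)

theorem sqrtFactorial_ne_zero (n : ι → ℕ) : (sqrtFactorial n : ℂ) ≠ 0 :=
  Complex.ofReal_ne_zero.2 (sqrtFactorial_pos n).ne'

/-- The vector `p(a†) |0⟩` of a polynomial `p`. -/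
def toFock : MvPolynomial ι ℂ →ₗ[ℂ] Fock ι where
  toFun p := ⟨fun n => sqrtFactorial n * coeff (multiIndex n) p, by
    refine (memℓp_two_iff _).2 ((sqSum_ne_top_iff _).2 ?_)
    refine summable_of_hasFiniteSupport ?_
    refine (p.support.finite_toSet.preimage (Finsupp.equivFunOnFinite.symm.injective.injOn)).subset
      fun n hn => ?_
    simp only [Set.mem_preimage, Finset.mem_coe, mem_support_iff]
    intro h
    exact hn (by simp [multiIndex, h])⟩
  map_add' p q := by
    ext n
    change _ * coeff _ (p + q) = _ * coeff _ p + _ * coeff _ q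
    rw [coeff_add, mul_add]
  map_smul' c p := by
    ext n
    change _ * coeff _ (c • p) = c * (_ * coeff _ p)
    rw [coeff_smul, smul_eq_mul]
    ring

theorem toFock_apply (p : MvPolynomial ι ℂ) (n : ι → ℕ) :
    toFock p n = sqrtFactorial n * coeff (multiIndex n) p := rfl

/-- The polynomial of the occupation number state `|n⟩`. -/
def ketPoly (n : ι → ℕ) : MvPolynomial ι ℂ := monomial (multiIndex n) (sqrtFactorial n : ℂ)⁻¹

theorem toFock_ketPoly (n : ι → ℕ) : toFock (ketPoly n) = ket n := by
  ext m
  classical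
  rw [toFock_apply, ketPoly, coeff_monomial, ket_apply]
  by_cases h : m = n
  · subst h
    simpa using mul_inv_cancel₀ (sqrtFactorial_ne_zero m)
  · have : multiIndex n ≠ multiIndex m := fun h' => h (Finsupp.equivFunOnFinite.symm.injective h').symm
    simp [h, this]

theorem monomial_eq_smul_ketPoly (m : ι →₀ ℕ) (c : ℂ) :
    monomial m c = (c * sqrtFactorial m) • ketPoly (m : ι → ℕ) := by
  have : multiIndex (m : ι → ℕ) = m := Finsupp.equivFunOnFinite.symm_apply_apply m
  rw [ketPoly, this, smul_monomial, smul_eq_mul, mul_assoc,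
    mul_inv_cancel₀ (sqrtFactorial_ne_zero _), mul_one]

/-- The substitution `X j ↦ ∑ k, C k j X k`. -/
def linSubst (C : Matrix ι ι ℂ) : MvPolynomial ι ℂ →ₐ[ℂ] MvPolynomial ι ℂ :=
  aeval fun j => ∑ k, C k j • X k

@[simp] theorem linSubst_X (C : Matrix ι ι ℂ) (j : ι) : linSubst C (X j) = ∑ k, C k j • X k :=
  aeval_X _ _

theorem inner_toFock_C (a : ℂ) (q : MvPolynomial ι ℂ) :
    ⟪toFock (MvPolynomial.C a), toFock q⟫_ℂ = star a * coeff 0 q := by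
  have h0 : sqrtFactorial (0 : ι → ℕ) = 1 := by simp [sqrtFactorial]
  have hz : multiIndex (0 : ι → ℕ) = 0 := by ext; simp
  have h : toFock (MvPolynomial.C a : MvPolynomial ι ℂ) = a • ket 0 := by
    rw [← toFock_ketPoly, ← map_smul, ketPoly, h0, hz, smul_monomial]
    simp
  rw [h, inner_smul_left, inner_ket_left, toFock_apply, h0, hz]
  simp

/-- Two bounded operators that agree on all occupation number states are equal. -/
theorem ext_ket {A B : Op ι} (h : ∀ n, A (ket n) = B (ket n)) : A = B := by
  ext1 ψ
  have hψ := lp.hasSum_single (E := fun _ : ι → ℕ => ℂ) (p := 2) (by norm_num) ψ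
  have hk : ∀ n, lp.single (E := fun _ : ι → ℕ => ℂ) 2 n (ψ n) = ψ n • ket n := by
    intro n
    rw [ket, ← lp.single_smul, smul_eq_mul, mul_one]
  simp only [hk] at hψ
  have hA := hψ.mapL A
  have hB := hψ.mapL B
  simp only [map_smul, h] at hA hB
  exact hA.unique hB

theorem linSubst_mul (C D : Matrix ι ι ℂ) : linSubst (C * D) = (linSubst C).comp (linSubst D) := by
  ext j : 1
  simp only [linSubst_X, AlgHom.comp_apply, map_sum, map_smul, Matrix.mul_apply, Finset.sum_smul,
    Finset.smul_sum, smul_smul]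
  rw [Finset.sum_comm]
  simp only [mul_comm]

theorem coeff_zero_linSubst (C : Matrix ι ι ℂ) (p : MvPolynomial ι ℂ) :
    coeff 0 (linSubst C p) = coeff 0 p := by
  have : (constantCoeff (R := ℂ) (σ := ι)).comp (linSubst C : MvPolynomial ι ℂ →+* _) =
      constantCoeff := by
    ext j
    · simp [linSubst]
    · simp
  exact congrArg (fun f => f p) this

variable [DecidableEq ι]

theorem multiIndex_add_single (n : ι → ℕ) (j : ι) :
    multiIndex (n + Pi.single j 1) = multiIndex n + Finsupp.single j 1 := by
  ext i
  simp [Finsupp.single_apply, Pi.single_apply, eq_comm]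

theorem sqrtFactorial_add_single (n : ι → ℕ) (j : ι) :
    sqrtFactorial (n + Pi.single j 1) = Real.sqrt (n j + 1) * sqrtFactorial n := by
  rw [sqrtFactorial, sqrtFactorial, ← Real.sqrt_mul (by positivity)]
  congr 1
  rw [Fintype.prod_eq_mul_prod_compl j, Fintype.prod_eq_mul_prod_compl j]
  have : ∏ i ∈ {j}ᶜ, (((n + Pi.single j 1 : ι → ℕ) i).factorial : ℝ) = ∏ i ∈ {j}ᶜ, ((n i).factorial : ℝ) :=
    Finset.prod_congr rfl fun i hi => by
      simp [Pi.single_eq_of_ne (show i ≠ j by simpa using hi)]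
  rw [this]
  simp [Nat.factorial_succ]
  ring

/-- In the polynomial model annihilation is differentiation and, by `creat_toFock`, creation is
multiplication by the variable. The factor `√(n!)` is chosen for this. -/
theorem annih_toFock (j : ι) (p : MvPolynomial ι ℂ) : annih j (toFock p) = toFock (pderiv j p) := by
  funext n
  have h : ((n j + 1 : ℝ) : ℂ) = Real.sqrt (n j + 1) * Real.sqrt (n j + 1) := by
    rw [← Complex.ofReal_mul, Real.mul_self_sqrt (by positivity)]
  rw [annih, toFock_apply, toFock_apply, coeff_pderiv, multiIndex_add_single,
    sqrtFactorial_add_single]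
  have h' : ((multiIndex n j : ℕ) : ℂ) + 1 = Real.sqrt (n j + 1) * Real.sqrt (n j + 1) := by
    rw [← h]
    simp
  rw [h']
  push_cast
  ring

theorem creat_toFock (j : ι) (p : MvPolynomial ι ℂ) : creat j (toFock p) = toFock (X j * p) := by
  funext n
  by_cases hn : n j = 0
  · rw [toFock_apply, coeff_X_mul']
    simp [creat, hn]
  · obtain ⟨m, rfl⟩ : ∃ m : ι → ℕ, n = m + Pi.single j 1 := ⟨_, (sub_single_add_single hn).symm⟩
    rw [creat, toFock_apply, toFock_apply, add_single_sub_single, multiIndex_add_single,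
      add_comm (multiIndex m), coeff_X_mul, sqrtFactorial_add_single]
    simp
    ring

theorem finiteNumber_toFock (p : MvPolynomial ι ℂ) : FiniteNumber (toFock p) := by
  refine (finiteNumber_iff _).2 fun j => ?_
  rw [annih_toFock]
  exact (memℓp_two_iff _).1 (lp.memℓp _)

theorem linSubst_one : linSubst (1 : Matrix ι ι ℂ) = AlgHom.id ℂ _ := by
  ext j : 1
  simp [Matrix.one_apply, ite_smul]

/-- The chain rule for a linear substitution. -/
theorem pderiv_linSubst (C : Matrix ι ι ℂ) (k : ι) (p : MvPolynomial ι ℂ) :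
    pderiv k (linSubst C p) = ∑ j, C k j • linSubst C (pderiv j p) := by
  induction p using MvPolynomial.induction_on with
  | C a => simp [linSubst]
  | add p q hp hq => simp [hp, hq, Finset.sum_add_distrib]
  | mul_X p i hp =>
    have hX : pderiv k (linSubst C (X i)) = MvPolynomial.C (C k i) := by
      simp [pderiv_X, Pi.single_apply, MvPolynomial.smul_eq_C_mul]
    rw [map_mul, Derivation.leibniz, hX, hp]
    simp only [Derivation.leibniz, pderiv_X, map_add, smul_add, Finset.sum_add_distrib, smul_eq_mul,
      map_mul]
    congr 1
    · rw [Finset.sum_eq_single i]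
      · simp [MvPolynomial.smul_eq_C_mul, mul_comm]
      · intro j _ hj
        simp [Pi.single_eq_of_ne hj.symm]
      · simp
    · rw [Finset.mul_sum]
      exact Finset.sum_congr rfl fun j _ => by rw [mul_smul_comm]

theorem inner_toFock_X_mul (j : ι) (p q : MvPolynomial ι ℂ) :
    ⟪toFock (X j * p), toFock q⟫_ℂ = ⟪toFock p, toFock (pderiv j q)⟫_ℂ := by
  rw [← inner_conj_symm, ← inner_conj_symm (toFock p)]
  congr 1
  refine (inner_annih_left j (fun n => ?_) fun n => ?_).symm
  · rw [annih_toFock]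
  · rw [creat_toFock]

/-- Multiplication by `X j` is adjoint to `∂_j`. Induction moves each variable of `p` onto `q` as a
derivative, where the chain rule contracts `Cᴴ * C` to the identity. Since `q` changes, it is kept
general. -/
theorem inner_linSubst {C : Matrix ι ι ℂ} (hC : Cᴴ * C = 1) (p q : MvPolynomial ι ℂ) :
    ⟪toFock (linSubst C p), toFock (linSubst C q)⟫_ℂ = ⟪toFock p, toFock q⟫_ℂ := by
  induction p using MvPolynomial.induction_on generalizing q with
  | C a =>
    have : linSubst C (MvPolynomial.C a) = MvPolynomial.C a := by simp [linSubst]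
    rw [this, inner_toFock_C, inner_toFock_C, coeff_zero_linSubst]
  | add p p' hp hp' => simp only [map_add, inner_add_left, hp, hp']
  | mul_X p j hp =>
    have h1 : ∀ k, ⟪toFock (X k * linSubst C p), toFock (linSubst C q)⟫_ℂ =
        ∑ l, C k l * ⟪toFock p, toFock (pderiv l q)⟫_ℂ := by
      intro k
      rw [inner_toFock_X_mul, pderiv_linSubst, map_sum, inner_sum]
      exact Finset.sum_congr rfl fun l _ => by rw [map_smul, inner_smul_right, hp]
    have h2 : ∀ l, ∑ k, star (C k j) * C k l = if j = l then 1 else 0 := by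
      intro l
      rw [← Matrix.one_apply, ← hC, Matrix.mul_apply]
      rfl
    rw [mul_comm p, inner_toFock_X_mul, map_mul, linSubst_X, Finset.sum_mul, map_sum, sum_inner]
    simp only [smul_mul_assoc, map_smul, inner_smul_left, h1, Finset.mul_sum, ← mul_assoc]
    rw [Finset.sum_comm]
    simp only [← Finset.sum_mul, starRingEnd_apply, h2]
    simp

section SecondQuant

variable (C : unitaryGroup ι ℂ)

theorem orthonormal_linSubst_ketPoly :
    Orthonormal ℂ fun n : ι → ℕ => toFock (linSubst C.1 (ketPoly n)) := by
  rw [orthonormal_iff_ite]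
  intro n m
  rw [inner_linSubst (mem_unitaryGroup_iff'.1 C.2), toFock_ketPoly, toFock_ketPoly, inner_ket_left,
    ket_apply]

theorem toFock_linSubst_mem_span (p : MvPolynomial ι ℂ) : toFock (linSubst C.1 p) ∈
    Submodule.span ℂ (Set.range fun n : ι → ℕ => toFock (linSubst C.1 (ketPoly n))) := by
  induction p using MvPolynomial.induction_on' with
  | monomial m c =>
    rw [monomial_eq_smul_ketPoly, map_smul, map_smul]
    exact Submodule.smul_mem _ _ (Submodule.subset_span ⟨m, rfl⟩)
  | add p q hp hq =>
    rw [map_add, map_add]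
    exact Submodule.add_mem _ hp hq

theorem linSubst_mul_star (p : MvPolynomial ι ℂ) : linSubst C.1 (linSubst (star C.1) p) = p := by
  rw [← AlgHom.comp_apply, ← linSubst_mul, mem_unitaryGroup_iff.1 C.2, linSubst_one]
  rfl

/-- The substitution is invertible, so every occupation number state lies in the span. -/
theorem span_linSubst_orthogonal :
    (Submodule.span ℂ (Set.range fun n : ι → ℕ => toFock (linSubst C.1 (ketPoly n))))ᗮ = ⊥ := by
  rw [Submodule.eq_bot_iff]
  intro x hx
  ext n
  rw [← inner_ket_left, ← toFock_ketPoly, ← linSubst_mul_star C (ketPoly n)]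
  exact (Submodule.mem_orthogonal _ _).1 hx _ (toFock_linSubst_mem_span C _)

/-- The second quantization of a unitary matrix. -/
def secondQuant : Uni ι :=
  (HilbertBasis.mkOfOrthogonalEqBot (orthonormal_linSubst_ketPoly C)
    (span_linSubst_orthogonal C)).repr.symm

theorem secondQuant_ket (n : ι → ℕ) :
    secondQuant C (ket n) = toFock (linSubst C.1 (ketPoly n)) := by
  have := (HilbertBasis.mkOfOrthogonalEqBot (orthonormal_linSubst_ketPoly C)
    (span_linSubst_orthogonal C)).repr_symm_single n
  rwa [HilbertBasis.coe_mkOfOrthogonalEqBot] at this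

theorem secondQuant_toFock (p : MvPolynomial ι ℂ) :
    secondQuant C (toFock p) = toFock (linSubst C.1 p) := by
  induction p using MvPolynomial.induction_on' with
  | monomial m c =>
    rw [monomial_eq_smul_ketPoly]
    simp only [map_smul]
    rw [toFock_ketPoly, secondQuant_ket]
  | add p q hp hq => simp only [map_add, hp, hq]

/-- Coordinates are inner products with `|n⟩`, and `|n⟩` is the image of a polynomial `q`. Moving
the operators onto `q` reduces the claim for arbitrary `ψ` to polynomial algebra. -/
theorem annih_secondQuant {ψ : Fock ι} (h : FiniteNumber ψ) (j : ι) :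
    annih j (secondQuant C ψ) = secondQuant C (linVec (C.1 j) 0 0 ψ h) := by
  funext n
  set q := linSubst (star C.1) (ketPoly n)
  have hq : secondQuant C (toFock q) = ket n := by
    rw [secondQuant_toFock, linSubst_mul_star, toFock_ketPoly]
  have h1 : linVec 0 (fun k => star (C.1 j k)) 0 (toFock q) (finiteNumber_toFock q) =
      toFock ((∑ k, star (C.1 j k) • X k) * q) := by
    ext m
    simp only [linVec_apply, linOp, creat_toFock, Finset.sum_mul, map_sum, smul_mul_assoc, map_smul,
      lp.coeFn_sum, lp.coeFn_smul, Finset.sum_apply, Pi.smul_apply, smul_eq_mul, Pi.zero_apply,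
      zero_mul, zero_add, add_zero]
  have h2 : linSubst C.1 ((∑ k, star (C.1 j k) • X k) * q) = X j * ketPoly n := by
    rw [map_mul, linSubst_mul_star]
    congr 1
    have := linSubst_mul_star C (X j)
    rwa [linSubst_X] at this
  have h3 : toFock (X j * ketPoly n) = (Real.sqrt (n j + 1) : ℂ) • ket (n + Pi.single j 1) := by
    ext m
    rw [← creat_toFock, toFock_ketPoly, creat_ket_apply, lp.coeFn_smul, Pi.smul_apply, ket_apply]
    simp
  have h4 := inner_linVec_left 0 (fun k => star (C.1 j k)) 0 (finiteNumber_toFock q) h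
  rw [h1, ← (secondQuant C).inner_map_map, secondQuant_toFock, h2, h3, inner_smul_left,
    inner_ket_left] at h4
  have h5 : linVec (fun k => star (star (C.1 j k))) (fun k => star ((0 : ι → ℂ) k)) (star 0) ψ h =
      linVec (C.1 j) 0 0 ψ h := by
    ext m
    simp [linOp]
  rw [← inner_ket_left n (secondQuant C _), ← hq, (secondQuant C).inner_map_map, ← h5, ← h4]
  simp [annih]

theorem implements_secondQuant : Implements (secondQuant C) C.1 0 0 := by
  intro ψ h
  refine ⟨(finiteNumber_iff _).2 fun j => ?_, fun j => annih_secondQuant C h j⟩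
  rw [annih_secondQuant C h]
  exact (memℓp_two_iff _).1 (lp.memℓp _)

theorem isGaussian_secondQuant : IsGaussian (secondQuant C) :=
  (isGaussian_iff _).2 ⟨C.1, 0, 0, by
    simpa [Matrix.star_eq_conjTranspose] using mem_unitaryGroup_iff.1 C.2, by simp,
    implements_secondQuant C⟩

theorem secondQuant_mul (D : unitaryGroup ι ℂ) (ψ : Fock ι) :
    secondQuant (C * D) ψ = secondQuant C (secondQuant D ψ) := by
  have : ((secondQuant (C * D)).toContinuousLinearEquiv : Op ι) =
      ((secondQuant C).toContinuousLinearEquiv : Op ι) ∘L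
        ((secondQuant D).toContinuousLinearEquiv : Op ι) := by
    refine ext_ket fun n => ?_
    change secondQuant (C * D) (ket n) = secondQuant C (secondQuant D (ket n))
    rw [secondQuant_ket, secondQuant_ket, secondQuant_toFock, Submonoid.coe_mul, linSubst_mul,
      AlgHom.comp_apply]
  exact congrArg (fun A : Op ι => A ψ) this

end SecondQuant

end HBAC

namespace HBAC

open MvPolynomial Matrix

/-! ### Strong continuity of one-parameter unitary groups -/

section OneParameter

variable {ι : Type} [Fintype ι]

/-- A one-parameter group of unitary operators is strongly continuous if it is continuous at `0` on
the occupation number states. -/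
theorem continuous_of_continuousAt_ket {V : ℝ → Uni ι}
    (hV : ∀ (θ θ' : ℝ) (ψ : Fock ι), V (θ + θ') ψ = V θ (V θ' ψ))
    (hc : ∀ n, ContinuousAt (fun θ => V θ (ket n)) 0) (ψ : Fock ι) :
    Continuous fun θ => V θ ψ := by
  have h0 : ∀ φ, V 0 φ = φ := fun φ => (V 0).injective (by rw [← hV, add_zero])
  have hzero : ∀ φ : Fock ι, ContinuousAt (fun θ => V θ φ) 0 := by
    let T : Submodule ℂ (Fock ι) :=
      { carrier := {φ | ContinuousAt (fun θ => V θ φ) 0}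
        add_mem' := fun {a b} ha hb => by
          simp only [Set.mem_ofPred_eq, map_add] at *
          exact ha.add hb
        zero_mem' := by
          simp only [Set.mem_ofPred_eq, map_zero]
          exact continuousAt_const
        smul_mem' := fun c a ha => by
          simp only [Set.mem_ofPred_eq, map_smul] at *
          exact ha.const_smul c }
    have hT : IsClosed (T : Set (Fock ι)) := by
      refine isClosed_of_closure_subset fun φ hφ => ?_
      change ContinuousAt (fun θ => V θ φ) 0
      refine Metric.continuousAt_iff'.2 fun ε hε => ?_
      obtain ⟨χ, hχ, hd⟩ := Metric.mem_closure_iff.1 hφ (ε / 3) (by positivity)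
      filter_upwards [Metric.continuousAt_iff'.1 (show ContinuousAt (fun θ => V θ χ) 0 from hχ)
        (ε / 3) (by positivity)] with θ hθ
      have t1 : dist (V θ φ) (V θ χ) < ε / 3 := by rwa [(V θ).dist_map]
      have t2 : dist (V 0 χ) (V 0 φ) < ε / 3 := by rwa [(V 0).dist_map, dist_comm]
      linarith [dist_triangle4 (V θ φ) (V θ χ) (V 0 χ) (V 0 φ)]
    intro φ
    have hφ := lp.hasSum_single (E := fun _ : ι → ℕ => ℂ) (p := 2) (by norm_num) φ
    refine hT.mem_of_tendsto hφ (Filter.Eventually.of_forall fun s => T.sum_mem fun n _ => ?_)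
    have hk : lp.single (E := fun _ : ι → ℕ => ℂ) 2 n (φ n) = φ n • ket n := by
      rw [ket, ← lp.single_smul, smul_eq_mul, mul_one]
    rw [hk]
    exact T.smul_mem _ (hc n)
  refine continuous_iff_continuousAt.2 fun θ => ?_
  have h1 : ContinuousAt (fun θ' => V θ (V (θ' - θ) ψ)) θ := by
    refine (V θ).continuous.continuousAt.comp ?_
    refine ContinuousAt.comp (g := fun t => V t ψ) (f := fun θ' => θ' - θ) ?_ (by fun_prop)
    rw [sub_self]
    exact hzero ψ
  refine h1.congr (Filter.Eventually.of_forall fun θ' => ?_)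
  simp only [← hV, add_sub_cancel]

variable [DecidableEq ι]

/-! ### SWAP -/

/-- The permutation matrix with the columns `e (σ j)`. -/
def permUnitary (σ : Equiv.Perm ι) : unitaryGroup ι ℂ :=
  ⟨Matrix.of fun k j => if k = σ j then 1 else 0, by
    rw [mem_unitaryGroup_iff']
    ext i j
    simp [Matrix.mul_apply, Matrix.one_apply, eq_comm]⟩

theorem secondQuant_permUnitary_ket (σ : Equiv.Perm ι) (n : ι → ℕ) :
    secondQuant (permUnitary σ) (ket n) = ket (n ∘ σ.symm) := by
  have h1 : linSubst (permUnitary σ).1 = rename σ := by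
    ext j : 1
    simp [permUnitary, ite_smul]
  have h2 : sqrtFactorial (n ∘ σ.symm) = sqrtFactorial n := by
    rw [sqrtFactorial, sqrtFactorial]
    congr 1
    exact Equiv.prod_comp σ.symm fun j => ((n j).factorial : ℝ)
  have h3 : (multiIndex n).mapDomain σ = multiIndex (n ∘ σ.symm) := by
    ext j
    simp [Finsupp.mapDomain_equiv_apply]
  rw [secondQuant_ket, h1, ← toFock_ketPoly, ketPoly, ketPoly, rename_monomial, h2, h3]

theorem isSwap_secondQuant (s m : ι) : IsSwap s m (secondQuant (permUnitary (Equiv.swap s m))) := by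
  intro n
  rw [secondQuant_permUnitary_ket, Equiv.symm_swap]

/-! ### One-parameter groups of second quantized unitary matrices -/

/-- The occupation numbers with the same total number as `n`. -/
def sameNumber (n : ι → ℕ) : Finset (ι → ℕ) := Finset.piAntidiag Finset.univ (∑ j, n j)

/-- A linear substitution preserves the degree. The sum is thus finite, over a range independent of
`C`, and derivatives in `C` may be taken coefficientwise. -/
theorem secondQuant_ket_eq_sum (C : unitaryGroup ι ℂ) (n : ι → ℕ) :
    secondQuant C (ket n) = ∑ l ∈ sameNumber n,
      (sqrtFactorial l * coeff (multiIndex l) (linSubst C.1 (ketPoly n))) • ket l := by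
  have hn : IsHomogeneous (ketPoly n) (∑ j, n j) := by
    refine isHomogeneous_monomial _ ?_
    simp [Finsupp.degree_eq_sum]
  have hom : IsHomogeneous (linSubst C.1 (ketPoly n)) (∑ j, n j) := by
    have := hn.aeval (fun j => ∑ k, C.1 k j • (X k : MvPolynomial ι ℂ)) (n := 1) fun j =>
      IsHomogeneous.sum _ _ _ fun k _ => by
        rw [MvPolynomial.smul_eq_C_mul]
        simpa using (isHomogeneous_C ι (C.1 k j)).mul (isHomogeneous_X ℂ k)
    rwa [one_mul] at this
  rw [secondQuant_ket]
  ext f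
  simp only [lp.coeFn_sum, lp.coeFn_smul, Finset.sum_apply, Pi.smul_apply, smul_eq_mul, ket_apply,
    mul_ite, mul_one, mul_zero]
  rw [Finset.sum_ite_eq, toFock_apply]
  split_ifs with hf
  · rfl
  · rw [hom.coeff_eq_zero, mul_zero]
    intro hd
    refine hf (Finset.mem_piAntidiag.2 ⟨?_, fun _ _ => Finset.mem_univ _⟩)
    simpa [Finsupp.degree_eq_sum] using hd

/-- A curve of algebra homomorphisms through the identity has a derivation as its tangent, and a
derivation is determined by its values on the variables. -/
theorem hasDerivAt_coeff_linSubst {R : ℝ → Matrix ι ι ℂ} {D : Matrix ι ι ℂ} (h0 : R 0 = 1)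
    (hR : ∀ k j, HasDerivAt (fun θ => R θ k j) (D k j) 0)
    (L : Derivation ℂ (MvPolynomial ι ℂ) (MvPolynomial ι ℂ))
    (hL : ∀ j, L (X j) = ∑ k, D k j • X k) (p : MvPolynomial ι ℂ) (l : ι →₀ ℕ) :
    HasDerivAt (fun θ => coeff l (linSubst (R θ) p)) (coeff l (L p)) 0 := by
  induction p using MvPolynomial.induction_on generalizing l with
  | C a =>
    have : ∀ θ, linSubst (R θ) (MvPolynomial.C a) = MvPolynomial.C a := fun θ => by simp [linSubst]
    simp only [this]
    have h : L (MvPolynomial.C a) = 0 := L.map_algebraMap a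
    rw [h, coeff_zero]
    exact hasDerivAt_const _ _
  | add p q hp hq =>
    simp only [map_add, coeff_add]
    exact (hp l).add (hq l)
  | mul_X p j hp =>
    have hcoeff : ∀ (M : Matrix ι ι ℂ) (q : MvPolynomial ι ℂ),
        coeff l (q * ∑ k, M k j • X k) = ∑ k, M k j * coeff l (q * X k) := by
      intro M q
      rw [Finset.mul_sum, coeff_sum]
      exact Finset.sum_congr rfl fun k _ => by rw [mul_smul_comm, coeff_smul, smul_eq_mul]
    have hk : ∀ k, HasDerivAt (fun θ => coeff l (linSubst (R θ) p * X k))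
        (coeff l (L p * X k)) 0 := by
      intro k
      simp only [coeff_mul_X']
      split_ifs with h
      · exact hp _
      · exact hasDerivAt_const _ _
    simp only [map_mul, linSubst_X, hcoeff]
    have key := HasDerivAt.fun_sum (u := Finset.univ) fun k _ => (hR k j).mul (hk k)
    refine key.congr_deriv ?_
    rw [Derivation.leibniz, hL, coeff_add, smul_eq_mul, smul_eq_mul, hcoeff, Finset.sum_add_distrib]
    congr 1
    · simp [h0, linSubst_one]
    · simp [h0, Matrix.one_apply, mul_comm]

/-- The derivative of a second quantized family of unitary matrices on occupation number states. -/
theorem hasDerivAt_secondQuant_ket {R : ℝ → unitaryGroup ι ℂ} {D : Matrix ι ι ℂ} (h0 : R 0 = 1)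
    (hR : ∀ k j, HasDerivAt (fun θ => (R θ).1 k j) (D k j) 0)
    (L : Derivation ℂ (MvPolynomial ι ℂ) (MvPolynomial ι ℂ))
    (hL : ∀ j, L (X j) = ∑ k, D k j • X k) (n : ι → ℕ) :
    HasDerivAt (fun θ => secondQuant (R θ) (ket n)) (toFock (L (ketPoly n))) 0 := by
  have h0' : (R 0).1 = 1 := by rw [h0]; rfl
  have hc := hasDerivAt_coeff_linSubst (R := fun θ => (R θ).1) h0' hR L hL (ketPoly n)
  have hsum : HasDerivAt (fun θ => secondQuant (R θ) (ket n)) (∑ l ∈ sameNumber n,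
      (sqrtFactorial l * coeff (multiIndex l) (L (ketPoly n))) • ket l) 0 := by
    simp only [secondQuant_ket_eq_sum]
    exact HasDerivAt.fun_sum fun l _ => ((hc (multiIndex l)).const_mul _).smul_const _
  refine hsum.congr_deriv ?_
  ext f
  simp only [lp.coeFn_sum, lp.coeFn_smul, Finset.sum_apply, Pi.smul_apply, smul_eq_mul, ket_apply,
    mul_ite, mul_one, mul_zero]
  rw [Finset.sum_ite_eq, toFock_apply]
  split_ifs with hf
  · rfl
  -- Outside the shell of fixed total number the coefficient vanishes for all `θ`, hence so does its
  -- derivative.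
  · have hz : ∀ θ, coeff (multiIndex f) (linSubst (R θ).1 (ketPoly n)) = 0 := by
      intro θ
      have h1 := congrArg (fun v : Fock ι => v f) (secondQuant_ket_eq_sum (R θ) n)
      simp only [lp.coeFn_sum, lp.coeFn_smul, Finset.sum_apply, Pi.smul_apply, smul_eq_mul,
        ket_apply, mul_ite, mul_one, mul_zero] at h1
      rw [Finset.sum_ite_eq, if_neg hf, secondQuant_ket, toFock_apply] at h1
      exact (mul_eq_zero.1 h1).resolve_left (sqrtFactorial_ne_zero f)
    have h1 := hc (multiIndex f)
    simp only [hz] at h1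
    rw [h1.unique (hasDerivAt_const _ _), mul_zero]

end OneParameter

/-! ### Beam splitter -/

section BeamSplitter

variable {ι : Type} [DecidableEq ι] (s m : ι)

/-- The projection onto the modes `s` and `m`. -/
def pairProj : Matrix ι ι ℂ := Matrix.single s s 1 + Matrix.single m m 1

/-- The exchange of the modes `s` and `m`. -/
def pairSwap : Matrix ι ι ℂ := Matrix.single s m 1 + Matrix.single m s 1

/-- The matrix `exp (-i θ (|s⟩⟨m| + |m⟩⟨s|))`. -/
def rotMatrix (θ : ℝ) : Matrix ι ι ℂ :=
  1 + (Complex.cos θ - 1) • pairProj s m + (-Complex.I * Complex.sin θ) • pairSwap s m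

variable {s m}

theorem rotMatrix_zero : rotMatrix s m 0 = 1 := by simp [rotMatrix]

theorem rotMatrix_norm_sq (h : s ≠ m) (θ : ℝ) (k : ι) : ‖rotMatrix s m θ s k‖ ^ 2 =
    if k = s then Real.cos θ ^ 2 else if k = m then Real.sin θ ^ 2 else 0 := by
  by_cases h1 : k = s
  · subst h1
    simp [rotMatrix, pairProj, pairSwap, h.symm, ← Complex.ofReal_cos]
  · by_cases h2 : k = m
    · subst h2
      simp [rotMatrix, pairProj, pairSwap, h, h.symm, ← Complex.ofReal_sin]
    · simp [rotMatrix, pairProj, pairSwap, h1, h2, Ne.symm h1, Ne.symm h2]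

variable [Fintype ι]

/-- With `P` the projection and `X` the exchange, `P² = X² = P` and `P X = X P = X`; the addition
theorems do the rest. -/
theorem rotMatrix_mul (h : s ≠ m) (θ θ' : ℝ) :
    rotMatrix s m θ * rotMatrix s m θ' = rotMatrix s m (θ + θ') := by
  have hPP : pairProj s m * pairProj s m = pairProj s m := by
    simp [pairProj, add_mul, mul_add, h, h.symm]
  have hPX : pairProj s m * pairSwap s m = pairSwap s m := by
    simp [pairProj, pairSwap, add_mul, mul_add, h, h.symm]
  have hXP : pairSwap s m * pairProj s m = pairSwap s m := by
    simp [pairProj, pairSwap, add_mul, mul_add, h, h.symm, add_comm]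
  have hXX : pairSwap s m * pairSwap s m = pairProj s m := by
    simp [pairProj, pairSwap, add_mul, mul_add, h, h.symm, add_comm]
  simp only [rotMatrix, add_mul, mul_add, one_mul, mul_one, smul_mul_assoc, mul_smul_comm, hPP, hPX,
    hXP, hXX, Complex.ofReal_add, Complex.cos_add, Complex.sin_add]
  have hI := Complex.I_mul_I
  match_scalars
  · ring
  · linear_combination (Complex.sin θ * Complex.sin θ') * hI
  · ring

theorem star_rotMatrix (θ : ℝ) : star (rotMatrix s m θ) = rotMatrix s m (-θ) := by
  have h1 : star (pairProj s m) = pairProj s m := by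
    simp [pairProj, Matrix.star_eq_conjTranspose]
  have h2 : star (pairSwap s m) = pairSwap s m := by
    simp [pairSwap, Matrix.star_eq_conjTranspose, add_comm]
  simp only [rotMatrix, star_add, star_one, star_smul, h1, h2]
  congr 2
  · simp [← Complex.cos_conj]
  · simp [← Complex.sin_conj]

/-- The matrix of the beam splitter. -/
def rotUnitary (h : s ≠ m) (θ : ℝ) : unitaryGroup ι ℂ :=
  ⟨rotMatrix s m θ, by
    rw [mem_unitaryGroup_iff, star_rotMatrix, rotMatrix_mul h, add_neg_cancel, rotMatrix_zero]⟩

theorem isBeamSplitterGroup_secondQuant (h : s ≠ m) :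
    IsBeamSplitterGroup s m fun θ => secondQuant (rotUnitary h θ) := by
  have hgroup : ∀ (θ θ' : ℝ) (ψ : Fock ι), secondQuant (rotUnitary h (θ + θ')) ψ =
      secondQuant (rotUnitary h θ) (secondQuant (rotUnitary h θ') ψ) := by
    intro θ θ' ψ
    rw [← secondQuant_mul]
    congr 2
    exact Subtype.ext (rotMatrix_mul h θ θ').symm
  have h0 : rotUnitary h 0 = 1 := Subtype.ext rotMatrix_zero
  have hR : ∀ k j, HasDerivAt (fun θ : ℝ => (rotUnitary h θ).1 k j)
      (((-Complex.I) • pairSwap s m) k j) 0 := by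
    intro k j
    have hcos : HasDerivAt (fun θ : ℝ => Complex.cos θ) 0 0 := by
      simpa using ((Complex.hasDerivAt_cos (0 : ℝ)).comp_ofReal)
    have hsin : HasDerivAt (fun θ : ℝ => Complex.sin θ) 1 0 := by
      simpa using ((Complex.hasDerivAt_sin (0 : ℝ)).comp_ofReal)
    have := (((hcos.sub_const 1).mul_const (pairProj s m k j)).const_add
      ((1 : Matrix ι ι ℂ) k j)).add ((hsin.const_mul (-Complex.I)).mul_const (pairSwap s m k j))
    refine this.congr_deriv ?_
    simp
  -- The generator `-i (a† b + a b†)` in the polynomial model.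
  let L : Derivation ℂ (MvPolynomial ι ℂ) (MvPolynomial ι ℂ) :=
    (-Complex.I) • ((X s : MvPolynomial ι ℂ) • pderiv m + (X m : MvPolynomial ι ℂ) • pderiv s)
  have hL : ∀ j, L (X j) = ∑ k, ((-Complex.I) • pairSwap s m) k j • X k := by
    intro j
    have h1 : ∀ a b : ι, ∑ k, (Matrix.single a b (1 : ℂ)) k j • (X k : MvPolynomial ι ℂ) =
        X a * pderiv b (X j) := by
      intro a b
      simp only [Matrix.single_apply, ite_smul, one_smul, zero_smul, pderiv_X, Pi.single_apply]
      by_cases hb : b = j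
      · simp [hb]
      · simp [hb, Ne.symm hb]
    simp only [pairSwap, Matrix.smul_apply, Matrix.add_apply, smul_assoc, add_smul]
    rw [← Finset.smul_sum, Finset.sum_add_distrib, h1, h1]
    rfl
  have hderiv := hasDerivAt_secondQuant_ket h0 hR L hL
  refine ⟨hgroup, continuous_of_continuousAt_ket hgroup fun n => (hderiv n).continuousAt,
    fun n φ hφ => ?_⟩
  refine (hderiv n).congr_deriv ?_
  have : toFock (L (ketPoly n)) = (-Complex.I) • toFock (X s * pderiv m (ketPoly n) +
      X m * pderiv s (ketPoly n)) := by
    rw [← map_smul]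
    rfl
  rw [this]
  congr 1
  ext k
  -- `a` and `b†` commute because they belong to different modes; this reconciles the order `a b†`
  -- with `X m * ∂_s`.
  have hcomm : pderiv s (X m * ketPoly n) = X m * pderiv s (ketPoly n) := by
    rw [Derivation.leibniz, pderiv_X_of_ne h.symm]
    simp
  rw [hφ, ← toFock_ketPoly, annih_toFock, creat_toFock, creat_toFock, annih_toFock, hcomm, map_add]
  rfl

end BeamSplitter

end HBAC

namespace HBAC

/-! ### Gaussian protocols -/

section Protocol

variable {N K : ℕ} {β ω₀ : ℝ} {ω : Fin N → ℝ} {ν : Fin K → ℝ}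

theorem freqSM_pos (hω₀ : 0 < ω₀) (hω : ∀ j, 0 < ω j) (j : SM N) : 0 < freqSM ω₀ ω j := by
  rcases j with j | j
  · exact hω₀
  · exact hω j

/-- The lower bound on the covariance matrix survives every Gaussian protocol. -/
theorem exists_ensemble_of_isGaussianProtocol {c : ℝ} (hβ : 0 < β) (hω₀ : 0 < ω₀)
    (hω : ∀ j, 0 < ω j) (hν : ∀ k, 0 < ν k) (hc : 0 ≤ c)
    (hcω : ∀ j, c ≤ occ β (freqSM ω₀ ω j)) (P : List (Round N K))
    (hP : IsGaussianProtocol ω₀ ω ν P) {I : Type} {ψ : I → Fock (SM N)} {ρ : Op (SM N)}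
    (h : IsEnsemble ψ ρ) (hb : NumberBound c ψ) :
    ∃ (J : Type) (φ : J → Fock (SM N)),
      IsEnsemble φ (P.foldl (fun ρ r => r.apply β ν ρ) ρ) ∧ NumberBound c φ := by
  induction P generalizing I ρ with
  | nil => exact ⟨I, ψ, h, hb⟩
  | cons r P ih =>
    obtain ⟨hV, hU, hE⟩ := hP r List.mem_cons_self
    obtain ⟨CV, SV, dV, -, -, HV⟩ := (isGaussian_iff _).1 hV
    obtain ⟨CU, SU, dU, -, -, HU⟩ := (isGaussian_iff _).1 hU
    have h1 := h.conj HV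
    exact ih (fun r' hr' => hP r' (List.mem_cons_of_mem r hr'))
      (isEnsemble_ptrace ((isEnsemble_tensorGibbs hβ hν h1).conj HU))
      ((hb.conj h hV).thermalize hc hβ (freqSM_pos hω₀ hω) hν hcω h1 hU hE)

theorem effInvTemp_outputS_le (hβ : 0 < β) (hω₀ : 0 < ω₀) (hω : ∀ j, 0 < ω j)
    (hν : ∀ k, 0 < ν k) {last : Fin N} (hlast : ∀ j, ω j ≤ ω last) (P : List (Round N K))
    (hP : IsGaussianProtocol ω₀ ω ν P) :
    effInvTemp ω₀ (outputS β ω₀ ω ν P) ≤ ((max 1 (ω last / ω₀) * β : ℝ) : EReal) := by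
  have hm : 0 < max ω₀ (ω last) := lt_max_of_lt_left hω₀
  have hc : 0 ≤ occ β (max ω₀ (ω last)) := (occ_pos (mul_pos hβ hm)).le
  have hpos := freqSM_pos hω₀ hω
  have hcω : ∀ j, occ β (max ω₀ (ω last)) ≤ occ β (freqSM ω₀ ω j) := by
    rintro (j | j)
    · exact occ_anti hβ hω₀ (le_max_left _ _)
    · exact occ_anti hβ (hω j) ((hlast j).trans (le_max_right _ _))
  obtain ⟨J, φ, h, hb⟩ := exists_ensemble_of_isGaussianProtocol hβ hω₀ hω hν hc hcω P hP
    (isEnsemble_gibbs hβ hpos) (numberBound_gibbs hβ hpos hc hcω)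
  have := effInvTemp_le hω₀ (mul_pos hβ hm) (hb.ptrace.le_thermalExcitation (isEnsemble_ptrace h))
  rwa [← max_div_div_right hω₀.le, div_self hω₀.ne'] at this

theorem isGaussianProtocol_rechargeOnly {V : Uni (SM N)} (hV : IsGaussian V) :
    IsGaussianProtocol ω₀ ω ν (rechargeOnly K V) := by
  intro r hr
  obtain rfl := List.mem_singleton.1 hr
  exact ⟨hV, isGaussian_refl, energyPreserving_refl _⟩

theorem thermalMoment_eq_ofReal {ι : Type} [Fintype ι] {μ : ι → ℝ} (hβ : 0 < β)
    (hμ : ∀ j, 0 < μ j) (u v : ι → ℂ) : thermalMoment β μ u v =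
      ENNReal.ofReal (∑ k, (‖u k‖ ^ 2 * occ β (μ k) + ‖v k‖ ^ 2 * (occ β (μ k) + 1))) := by
  have h : ∀ k, 0 ≤ occ β (μ k) := fun k => (occ_pos (mul_pos hβ (hμ k))).le
  rw [ENNReal.ofReal_sum_of_nonneg fun k _ =>
    add_nonneg (mul_nonneg (by positivity) (h k)) (mul_nonneg (by positivity) (by linarith [h k]))]
  refine Finset.sum_congr rfl fun k _ => ?_
  have := h k
  rw [ENNReal.ofReal_add (by positivity) (by positivity), ENNReal.ofReal_mul (by positivity),
    ENNReal.ofReal_mul (by positivity), ENNReal.ofReal_add this zero_le_one, enorm_sq_eq_ofReal,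
    enorm_sq_eq_ofReal, ENNReal.ofReal_one]

/-- A passive linear recharging unitary brings the target mode into a thermal state, whose mean
excitation number is a convex combination of the thermal ones. -/
theorem thermalExcitation_rechargeOnly (hβ : 0 < β) (hω₀ : 0 < ω₀) (hω : ∀ j, 0 < ω j)
    (hν : ∀ k, 0 < ν k) (C : Matrix.unitaryGroup (SM N) ℂ) :
    thermalExcitation (outputS β ω₀ ω ν (rechargeOnly K (secondQuant C))) =
      ENNReal.ofReal (∑ k, ‖C.1 (Sum.inl ()) k‖ ^ 2 * occ β (freqSM ω₀ ω k)) := by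
  have hpos := freqSM_pos hω₀ hω
  have hV := implements_secondQuant C
  have h0 := isEnsemble_gibbs hβ hpos
  have h1 := h0.conj hV
  have h2 := (isEnsemble_tensorGibbs hβ hν h1).conj implements_refl
  have h3 := isEnsemble_ptrace (isEnsemble_ptrace h2)
  -- All affine `A` are needed, since the thermal excitation is an infimum over Gaussian unitaries.
  -- The identity attains the value for `A = a`, and the invariant shows that no other unitary lies
  -- below it.
  have hmom : ∀ u v : Unit → ℂ, ∀ d, moment (ptraceVec (ptraceVec fun x =>
      LinearIsometryEquiv.refl ℂ (Fock (SM N ⊕ Fin K))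
        (tensorGibbsVec β ν (fun n => secondQuant C (gibbsVec β (freqSM ω₀ ω) n)) x))) u v d =
      ENNReal.ofReal (∑ k, (‖u () * C.1 (Sum.inl ()) k‖ ^ 2 * occ β (freqSM ω₀ ω k) +
        ‖v () * star (C.1 (Sum.inl ()) k)‖ ^ 2 * (occ β (freqSM ω₀ ω k) + 1))) + ‖d‖ₑ ^ 2 := by
    intro u v d
    have hz : thermalMoment β ν (0 : Fin K → ℂ) 0 = 0 := by simp [thermalMoment]
    rw [moment_ptrace, moment_ptrace]
    simp only [LinearIsometryEquiv.coe_refl, id_eq]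
    rw [moment_tensorGibbs hβ hν h1]
    have e : ∀ w : SM N → ℂ, (Sum.elim w fun _ => 0 : SM N ⊕ Fin K → ℂ) ∘ Sum.inr = 0 :=
      fun w => rfl
    rw [e, e, hz, add_zero, Sum.elim_comp_inl, Sum.elim_comp_inl, moment_conj h0 hV,
      moment_gibbs hβ hpos, thermalMoment_eq_ofReal hβ hpos]
    simp [Fintype.sum_sum_type]
  refine le_antisymm ((thermalExcitation_le h3).trans_eq ?_) (NumberBound.le_thermalExcitation
    (fun u v d => ?_) h3)
  · rw [hmom]
    simp
  · rw [hmom]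
    refine (ENNReal.ofReal_le_ofReal ?_).trans le_self_add
    rw [Finset.sum_add_distrib]
    have hm : 0 ≤ ∑ k, ‖C.1 (Sum.inl ()) k‖ ^ 2 * occ β (freqSM ω₀ ω k) :=
      Finset.sum_nonneg fun k _ => mul_nonneg (by positivity) (occ_pos (mul_pos hβ (hpos k))).le
    have hv : 0 ≤ ∑ k, ‖v () * star (C.1 (Sum.inl ()) k)‖ ^ 2 * (occ β (freqSM ω₀ ω k) + 1) :=
      Finset.sum_nonneg fun k _ => mul_nonneg (by positivity)
        (by linarith [occ_pos (mul_pos hβ (hpos k))])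
    have hu : ∑ k, ‖u () * C.1 (Sum.inl ()) k‖ ^ 2 * occ β (freqSM ω₀ ω k) =
        ‖u ()‖ ^ 2 * ∑ k, ‖C.1 (Sum.inl ()) k‖ ^ 2 * occ β (freqSM ω₀ ω k) := by
      rw [Finset.mul_sum]
      exact Finset.sum_congr rfl fun k _ => by rw [norm_mul]; ring
    rw [hu]
    simp only [Finset.univ_unique, Finset.sum_singleton]
    have : 0 ≤ ‖v default‖ ^ 2 := by positivity
    have e : (default : Unit) = () := rfl
    rw [e] at *
    nlinarith

theorem exists_swap (hβ : 0 < β) (hω₀ : 0 < ω₀) (hω : ∀ j, 0 < ω j) (hν : ∀ k, 0 < ν k)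
    (m : Fin N) : ∃ V : Uni (SM N), IsSwap (Sum.inl ()) (Sum.inr m) V ∧
      IsGaussianProtocol ω₀ ω ν (rechargeOnly K V) ∧
      effInvTemp ω₀ (outputS β ω₀ ω ν (rechargeOnly K V)) = ((ω m / ω₀ * β : ℝ) : EReal) := by
  refine ⟨_, isSwap_secondQuant _ _, isGaussianProtocol_rechargeOnly (isGaussian_secondQuant _),
    effInvTemp_eq hω₀ (mul_pos hβ (hω m)) ?_⟩
  rw [thermalExcitation_rechargeOnly hβ hω₀ hω hν]
  congr 1
  rw [Finset.sum_eq_single (Sum.inr m)]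
  · simp [permUnitary, freqSM]
  · intro k _ hk
    have : ¬ (Sum.inl () = Equiv.swap (Sum.inl ()) (Sum.inr m) k) := fun h =>
      hk (by rw [Equiv.eq_symm_apply _ |>.2 h.symm]; simp)
    simp [permUnitary, this]
  · simp

theorem exists_beamSplitter (hβ : 0 < β) (hω₀ : 0 < ω₀) (hω : ∀ j, 0 < ω j)
    (hν : ∀ k, 0 < ν k) (m : Fin N) :
    ∃ V : ℝ → Uni (SM N), IsBeamSplitterGroup (Sum.inl ()) (Sum.inr m) V ∧
      ∀ lam : ℝ, 1 ≤ lam → lam * ω₀ ≤ ω m →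
        ∃ θ : ℝ, IsGaussianProtocol ω₀ ω ν (rechargeOnly K (V θ)) ∧
          effInvTemp ω₀ (outputS β ω₀ ω ν (rechargeOnly K (V θ))) = ((lam * β : ℝ) : EReal) := by
  have hne : (Sum.inl () : SM N) ≠ Sum.inr m := Sum.inl_ne_inr
  refine ⟨_, isBeamSplitterGroup_secondQuant hne, fun lam h1 h2 => ?_⟩
  have hlω : 0 < lam * ω₀ := by positivity
  have hle : ω₀ ≤ lam * ω₀ := by nlinarith
  -- The excitation runs continuously from the occupation at `ω₀` for `θ = 0` to the one at `ω m`
  -- for `θ = π / 2`. The target occupation lies between them because `ω₀ ≤ lam * ω₀ ≤ ω m`.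
  obtain ⟨θ, -, hθ⟩ : occ β (lam * ω₀) ∈
      (fun θ : ℝ => Real.cos θ ^ 2 * occ β ω₀ + Real.sin θ ^ 2 * occ β (ω m)) ''
        Set.Icc 0 (Real.pi / 2) := by
    refine intermediate_value_Icc' (by positivity) (by fun_prop) ?_
    simpa using ⟨occ_anti hβ hlω h2, occ_anti hβ hω₀ hle⟩
  refine ⟨θ, isGaussianProtocol_rechargeOnly (isGaussian_secondQuant _), ?_⟩
  have := effInvTemp_eq (ρ := outputS β ω₀ ω ν (rechargeOnly K (secondQuant (rotUnitary hne θ))))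
    hω₀ (mul_pos hβ hlω) (by
      rw [thermalExcitation_rechargeOnly hβ hω₀ hω hν, ← hθ]
      congr 1
      simp only [rotUnitary, rotMatrix_norm_sq hne, Fintype.sum_sum_type]
      simp [freqSM, ite_mul])
  rwa [mul_div_cancel_right₀ _ hω₀.ne'] at this

end Protocol

end HBAC

end

/-! ### The main theorem -/

open HBAC
theorem theorem1 (N K : ℕ) (hN : 0 < N) (β ω₀ : ℝ) (hβ : 0 < β) (hω₀ : 0 < ω₀)
    (ω : Fin N → ℝ) (hω : ∀ j, 0 < ω j) (hmono : Monotone ω)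
    (ν : Fin K → ℝ) (hν : ∀ k, 0 < ν k) (last : Fin N) (hlast : (last : ℕ) + 1 = N) :
    -- the inverse temperature `lam * β` can be reached if and only if `ω_N ≥ lam * ω₀`
    (∀ lam : ℝ, 1 < lam →
      ((∃ P : List (Round N K), IsGaussianProtocol ω₀ ω ν P ∧
          effInvTemp ω₀ (outputS β ω₀ ω ν P) = ((lam * β : ℝ) : EReal)) ↔
        lam * ω₀ ≤ ω last)) ∧
    -- the upper bound for all Gaussian protocols
    (∀ P : List (Round N K), IsGaussianProtocol ω₀ ω ν P →
      effInvTemp ω₀ (outputS β ω₀ ω ν P) ≤ ((max 1 (ω last / ω₀) * β : ℝ) : EReal)) ∧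
    -- one SWAP with the last machine mode gives the value `(ω_N / ω₀) β`
    (∃ V : Uni (SM N), IsSwap (Sum.inl ()) (Sum.inr last) V ∧
      IsGaussianProtocol ω₀ ω ν (rechargeOnly K V) ∧
      effInvTemp ω₀ (outputS β ω₀ ω ν (rechargeOnly K V)) = ((ω last / ω₀ * β : ℝ) : EReal)) ∧
    -- one beam splitter with the last machine mode reaches every admissible `lam * β`
    (∃ V : ℝ → Uni (SM N), IsBeamSplitterGroup (Sum.inl ()) (Sum.inr last) V ∧
      ∀ lam : ℝ, 1 ≤ lam → lam * ω₀ ≤ ω last →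
        ∃ θ : ℝ, IsGaussianProtocol ω₀ ω ν (rechargeOnly K (V θ)) ∧
          effInvTemp ω₀ (outputS β ω₀ ω ν (rechargeOnly K (V θ))) = ((lam * β : ℝ) : EReal)) := by
  have hmax : ∀ j, ω j ≤ ω last := fun j => hmono (Fin.le_def.2 (by omega))
  have hbound := fun P : List (Round N K) =>
    effInvTemp_outputS_le (P := P) hβ hω₀ hω hν hmax
  have hbs := exists_beamSplitter (K := K) (ν := ν) hβ hω₀ hω hν last
  refine ⟨fun lam hlam => ⟨?_, fun h => ?_⟩, hbound, exists_swap hβ hω₀ hω hν last, hbs⟩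
  · rintro ⟨P, hP, hval⟩
    have h := hbound P hP
    rw [hval, EReal.coe_le_coe_iff] at h
    -- The alternative `lam ≤ 1` is excluded, so the bound by `ω last / ω₀` is the active one.
    rcases le_max_iff.1 (le_of_mul_le_mul_right h hβ) with h1 | h1
    · exact absurd h1 (not_le.2 hlam)
    · exact (le_div_iff₀ hω₀).1 h1
  · obtain ⟨V, -, hV⟩ := hbs
    obtain ⟨θ, h1, h2⟩ := hV lam hlam.le h
    exact ⟨_, h1, h2⟩
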